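/- **Setting.** Let $d\ge 2$ and let $S_1,S_2,\dots$ be independent simple random walks on $\mathbb Z^d$ started at the origin. Internal DLA is the random sequence of clusters $A(0)=\emptyset$, $A(k)=A(k-1)\cup\{S_k(\tau_k)\}$, where $\tau_k=\inf\{t\ge 0: S_k(t)\notin A(k-1)\}$. For real $r$ let $\mathbb B(0,r)=\{z\in\mathbb Z^d:\|z\|<r\}$ ($\|\cdot\|$ the Euclidean norm), and for an integer $n\ge 0$ put $b(n)=|\mathbb B(0,n)|$. The inner error $\delta_I(n)$ and the outer error $\delta_O(n)$ are defined by $$n-\delta_I(n)=\sup\{r\ge 0:\ \mathbb B(0,r)\subset A(b(n))\},\qquad n+\delta_O(n)=\inf\{r\ge 0:\ A(b(n))\subset \mathbb B(0,r)\}.$$ Set $h(k)=\sqrt{\log k}$ if $d\ge 3$, and $h(k)=\sqrt{\log k\,\cdot\log\log k}$ if $d=2$. **Proposition 1.2.** For every $d\ge 2$ there is a constant $\alpha_d>0$ such that $$\lim_{n\to\infty}P\big(\exists\, k>n,\ \delta_O(k)\ge \alpha_d\,h(k)\ \big|\ \delta_I(n)<\alpha_d\,h(n)\big)=1,$$ where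 $n$ and $k$ are integers. Moreover, with the same constant, almost surely, for infinitely many $n$, $$\delta_I(n)\ge\alpha_d\sqrt{\log n}\quad\text{or}\quad \delta_O(n)\ge\alpha_d\sqrt{\log n}.$$ -/

import Mathlib

open MeasureTheory ProbabilityTheory Filter Topology

namespace InternalDLA

/-- The Euclidean norm of a site of the lattice `ℤ^d`. -/
noncomputable def latticeNorm {d : ℕ} (z : Fin d → ℤ) : ℝ :=
  ‖(WithLp.toLp 2 (fun i => (z i : ℝ)) : EuclideanSpace ℝ (Fin d))‖

/-- The sites of `ℤ^d` in the open Euclidean ball of radius `r` centered at the origin. -/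
def latticeBall (d : ℕ) (r : ℝ) : Set (Fin d → ℤ) :=
  {z | latticeNorm z < r}

/-- Lattice balls are finite, so that counting their sites with `Set.ncard` is meaningful. -/
theorem latticeBall_finite (d : ℕ) (r : ℝ) : (latticeBall d r).Finite := by
  refine (Set.Finite.pi' (t := fun _ : Fin d => Set.Icc (-⌈r⌉) ⌈r⌉)
    (fun _ => Set.finite_Icc _ _)).subset ?_
  intro z hz i
  have h1 : |(z i : ℝ)| ≤ latticeNorm z := by
    have := PiLp.norm_apply_le (p := 2)
      (WithLp.toLp 2 (fun i => (z i : ℝ)) : EuclideanSpace ℝ (Fin d)) i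
    simpa [latticeNorm] using this
  have h2 : |(z i : ℝ)| < r := lt_of_le_of_lt h1 hz
  have h3 : |(z i : ℝ)| ≤ (⌈r⌉ : ℤ) := h2.le.trans (Int.le_ceil r)
  have h4 : |z i| ≤ ⌈r⌉ := by exact_mod_cast h3
  exact abs_le.mp h4

/-- The number `b(n)` of lattice sites in the ball of radius `n`. -/
noncomputable def ballVolume (d n : ℕ) : ℕ := (latticeBall d n).ncard

/-- `S k`, for `k : ℕ`, are independent simple random walks on `ℤ^d` started at the origin:
each `S k t` is a random variable, and all the steps of all the walks are independent, each one
uniformly distributed on the `2 * d` unit vectors of `ℤ^d`. -/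
structure AreIndepSimpleRandomWalks {Ω : Type*} [MeasurableSpace Ω] (μ : Measure Ω) {d : ℕ}
    (S : ℕ → ℕ → Ω → (Fin d → ℤ)) : Prop where
  measurable : ∀ k t, Measurable (S k t)
  start : ∀ k ω, S k 0 ω = 0
  step : ∀ k t (e : Fin d → ℤ), latticeNorm e = 1 →
    μ {ω | S k (t + 1) ω - S k t ω = e} = (2 * (d : ENNReal))⁻¹
  indep : iIndepFun (fun (p : ℕ × ℕ) ω => S p.1 (p.2 + 1) ω - S p.1 p.2 ω) μ

/-- The first time at which the path `w` is outside the explored region `A`. (A path which never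
leaves `A` gets the value `0`; such a path started in `A` then adds no site to the cluster. For
the walks considered here and finite `A` this happens with probability zero.) -/
noncomputable def settlingTime {d : ℕ} (w : ℕ → (Fin d → ℤ)) (A : Set (Fin d → ℤ)) : ℕ :=
  sInf {t | w t ∉ A}

/-- The internal DLA cluster, started from the empty region, after the explorers
`w 0, …, w (N - 1)` have settled one after the other. -/
noncomputable def cluster {d : ℕ} (w : ℕ → ℕ → (Fin d → ℤ)) : ℕ → Set (Fin d → ℤ)
  | 0 => ∅
  | N + 1 => cluster w N ∪ {w N (settlingTime (w N) (cluster w N))}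

/-- The inner error: `n - innerError w n` is the supremum of the radii `r ≥ 0` such that the
lattice ball of radius `r` is contained in the cluster of `b(n)` explorers. -/
noncomputable def innerError {d : ℕ} (w : ℕ → ℕ → (Fin d → ℤ)) (n : ℕ) : ℝ :=
  n - sSup {r : ℝ | 0 ≤ r ∧ latticeBall d r ⊆ cluster w (ballVolume d n)}

/-- The outer error: `n + outerError w n` is the infimum of the radii `r ≥ 0` such that the
cluster of `b(n)` explorers is contained in the lattice ball of radius `r`. -/
noncomputable def outerError {d : ℕ} (w : ℕ → ℕ → (Fin d → ℤ)) (n : ℕ) : ℝ :=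
  sInf {r : ℝ | 0 ≤ r ∧ cluster w (ballVolume d n) ⊆ latticeBall d r} - n

/-- The scale `h`: `√(log k · log log k)` in dimension two, and `√(log k)` in higher dimension. -/
noncomputable def errorScale (d k : ℕ) : ℝ :=
  if d = 2 then √(Real.log k * Real.log (Real.log k)) else √(Real.log k)

end InternalDLA

/-! ### Law of the steps, and the one-step Markov property. -/

namespace InternalDLA

/-! Let `h` be the error scale and `g = ⌈α h(n)⌉`. A small inner error at `n` means that `A(b(n))`
contains the ball `D` of radius `m = n - g`. The next explorers, as many as there are sites with
norm in `[n, k)` where `k = n + d g + 1`, then very probably build a thin tentacle from the boundary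
of `D`, so long that its tip has norm at least `k + α h(k)`.

For each site `z` of the shell `m ≤ ‖z‖ < m + 1`, fix sites `t z 0, …, t z (J - 1)` and cut the new
explorers into `J` blocks. The `j`-th block succeeds for `z` if one of its explorers leaves `D` at
`z` and then reaches `t z j` through the earlier tentacle sites. If all blocks succeed, the tentacle
is occupied, whatever else the explorers do (`mem_cluster_of_blocks`). These events involve only new
explorers, hence are independent of the conditioning. With `p z` the exit probability at `z` and `q
j` a lower bound for the cost of the second leg, an explorer works with probability at least `p z *
q j`.

Put `s = n^(1/4)`. By `large_or_many_successes`, either some `p z` is at least `s⁻²`, and that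
tentacle is built with probability at least `1 - 2/s`; or the mass of `p` is spread over at least
`s²/2` usable sites, each succeeding with probability at least `s⁻¹`. In the latter case the
successes at different `z` are negatively correlated, because an explorer has only one exit site,
and Chebyshev's inequality bounds the probability of no success by `2/s`.

It remains to find tentacles of length of order `g` with `∏ q j / (16 d J) ≥ s⁻¹`. A straight
segment costs `exp(-C g²)`, which gives `g` of order `√(log n)` when `d ≥ 3`. In the plane a
tentacle whose width is halved at each of about `log log n` stages costs only `exp(-C g² / log log
n)` up to lower order terms, because wide stages are cheap to cross (`exp_neg_le_hitProb_crossing`).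
This is the gain in `h`.

The almost sure statement follows: if both errors eventually stayed below `α √(log n)`, then for all
large `m` a small inner error at `m` would never be followed by a large outer error, an event of
probability at most `2/m^(1/4)`. -/

/-- The `2 * d` unit vectors of `ℤ^d`. -/
def unitStep {d : ℕ} (p : Fin d × Bool) : Fin d → ℤ :=
  Pi.single p.1 (if p.2 then 1 else -1)

theorem latticeNorm_unitStep {d : ℕ} (p : Fin d × Bool) : latticeNorm (unitStep p) = 1 := by
  have : (fun i => ((unitStep p i : ℤ) : ℝ)) = Pi.single p.1 (if p.2 then (1 : ℝ) else -1) := by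
    funext i
    unfold unitStep
    by_cases h : i = p.1
    · subst h; simp only [Pi.single_eq_same]; cases p.2 <;> simp
    · simp [Pi.single_eq_of_ne h]
  unfold latticeNorm
  rw [this]
  have := PiLp.norm_single 2 (fun _ : Fin d => ℝ) p.1 (if p.2 then (1 : ℝ) else -1)
  rw [PiLp.toLp_single]
  refine this.trans ?_
  split_ifs <;> simp

theorem unitStep_injective {d : ℕ} : Function.Injective (unitStep (d := d)) := by
  rintro ⟨i, a⟩ ⟨j, b⟩ h
  have hi : unitStep (i, a) i = unitStep (j, b) i := congrFun h i
  by_cases hij : i = j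
  · subst hij
    cases a <;> cases b <;> simp_all [unitStep]
  · rw [unitStep, unitStep, Pi.single_eq_same, Pi.single_eq_of_ne hij] at hi
    dsimp only at hi
    split_ifs at hi
    simp at hi

/-- The law of one step of simple random walk. -/
noncomputable def stepLaw (d : ℕ) : Measure (Fin d → ℤ) :=
  ∑ p : Fin d × Bool, (2 * (d : ENNReal))⁻¹ • Measure.dirac (unitStep p)

theorem two_mul_inv_mul_card (d : ℕ) [NeZero d] :
    ∑ _p : Fin d × Bool, (2 * (d : ENNReal))⁻¹ = 1 := by
  have h0 : (2 * (d : ENNReal)) ≠ 0 := by simp [NeZero.ne d]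
  have h1 : (2 * (d : ENNReal)) ≠ ⊤ := ENNReal.mul_ne_top (by simp) (by simp)
  simp only [Finset.sum_const, Finset.card_univ, Fintype.card_prod, Fintype.card_fin,
    Fintype.card_bool, nsmul_eq_mul, Nat.cast_mul, Nat.cast_ofNat]
  rw [mul_comm (d : ENNReal) 2]
  exact ENNReal.mul_inv_cancel h0 h1

instance (d : ℕ) [NeZero d] : IsProbabilityMeasure (stepLaw d) := by
  constructor
  simp [stepLaw, -Finset.sum_const, two_mul_inv_mul_card]

/-- The prescribed atoms already have total mass one, so nothing is left for other sites: `stepLaw d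
≤ ρ` with equal total masses. -/
theorem eq_stepLaw {d : ℕ} [NeZero d] (ρ : Measure (Fin d → ℤ)) [IsProbabilityMeasure ρ]
    (h : ∀ p, ρ {unitStep p} = (2 * (d : ENNReal))⁻¹) : ρ = stepLaw d := by
  classical
  refine (Measure.eq_of_le_of_measure_univ_eq ?_ (by simp)).symm
  refine Measure.le_iff.2 fun A hA => ?_
  have h1 : stepLaw d A = ∑ p with unitStep p ∈ A, ρ {unitStep p} := by
    simp only [stepLaw, Measure.coe_finsetSum, Finset.sum_apply, Measure.smul_apply,
      Measure.dirac_apply, smul_eq_mul, h]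
    rw [Finset.sum_filter]
    refine Finset.sum_congr rfl fun p _ => ?_
    by_cases hp : unitStep p ∈ A <;> simp [hp]
  rw [h1, ← measure_biUnion_finset]
  · refine measure_mono ?_
    intro x hx
    simp only [Set.mem_iUnion] at hx
    obtain ⟨p, hp, hx⟩ := hx
    rw [Set.mem_singleton_iff] at hx
    simp at hp
    rwa [hx]
  · intro p _ q _ hpq
    simpa [Function.onFun] using fun h => hpq (unitStep_injective h)
  · intro p _
    exact measurableSet_singleton _

/-- The law of the sequence of steps of simple random walk. -/
noncomputable def stepsLaw (d : ℕ) [NeZero d] : Measure (ℕ → Fin d → ℤ) :=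
  Measure.infinitePi fun _ => stepLaw d

instance (d : ℕ) [NeZero d] : IsProbabilityMeasure (stepsLaw d) := by
  unfold stepsLaw; infer_instance

/-- Prepend a step to a sequence of steps. -/
def consStep {α : Type*} (e : α) (ξ : ℕ → α) : ℕ → α
  | 0 => e
  | t + 1 => ξ t

theorem measurable_consStep {α : Type*} [MeasurableSpace α] :
    Measurable fun p : α × (ℕ → α) => consStep p.1 p.2 := by
  refine measurable_pi_iff.2 fun t => ?_
  cases t with
  | zero => exact measurable_fst
  | succ t => exact (measurable_pi_apply t).comp measurable_snd

/-- The Markov property at time one, checked on cylinder sets. It is the source of every harmonicity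
relation below. -/
theorem map_consStep (d : ℕ) [NeZero d] :
    ((stepLaw d).prod (stepsLaw d)).map (fun p => consStep p.1 p.2) = stepsLaw d := by
  classical
  refine Measure.eq_infinitePi _ fun s t ht => ?_
  obtain ⟨n, hn⟩ : ∃ n, s ⊆ Finset.range (n + 1) := by
    obtain ⟨n, hn⟩ := s.exists_nat_subset_range
    exact ⟨n, hn.trans (Finset.range_subset_range.2 (by lia))⟩
  set t' : ℕ → Set (Fin d → ℤ) := fun i => if i ∈ s then t i else Set.univ with ht'
  have hm : ∀ i, MeasurableSet (t' i) := fun i => by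
    by_cases h : i ∈ s <;> simp [ht', h, ht]
  have hset : Set.pi (s : Set ℕ) t = Set.pi (Finset.range (n + 1) : Set ℕ) t' := by
    ext ξ
    simp only [Set.mem_pi, Finset.mem_coe, ht']
    constructor
    · intro h i _
      by_cases hi : i ∈ s
      · simpa [hi] using h i hi
      · simp [hi]
    · intro h i hi
      simpa [hi] using h i (hn hi)
  have hprod : ∏ i ∈ s, stepLaw d (t i) = ∏ i ∈ Finset.range (n + 1), stepLaw d (t' i) := by
    rw [← Finset.prod_subset hn]
    · exact Finset.prod_congr rfl fun i hi => by simp [ht', hi]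
    · intro i _ hi
      simp [ht', hi]
  have hpre : (fun p : (Fin d → ℤ) × (ℕ → Fin d → ℤ) => consStep p.1 p.2) ⁻¹'
      (Set.pi (Finset.range (n + 1) : Set ℕ) t') =
      t' 0 ×ˢ Set.pi (Finset.range n : Set ℕ) (fun i => t' (i + 1)) := by
    ext ⟨e, ξ⟩
    simp only [Set.mem_preimage, Set.mem_pi, Finset.mem_coe, Finset.mem_range, Set.mem_prod]
    constructor
    · intro h
      exact ⟨h 0 (by lia), fun i hi => h (i + 1) (by lia)⟩
    · rintro ⟨h0, h1⟩ i hi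
      cases i with
      | zero => exact h0
      | succ i => exact h1 i (by lia)
  rw [hset, hprod, Measure.map_apply measurable_consStep
    (.pi (Finset.countable_toSet _) fun _ _ => hm _), hpre, Measure.prod_prod, stepsLaw,
    Measure.infinitePi_pi _ (fun i _ => hm _), Finset.prod_range_succ', mul_comm]

/-- The uniform average over the nearest neighbours of a site. -/
noncomputable def neighborAverage {d : ℕ} (f : (Fin d → ℤ) → ℝ) (x : Fin d → ℤ) : ℝ :=
  (2 * (d : ℝ))⁻¹ * ∑ p : Fin d × Bool, f (x + unitStep p)

theorem stepsLaw_real_eq_sum {d : ℕ} [NeZero d] {A : Set (ℕ → Fin d → ℤ)} (hA : MeasurableSet A) :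
    (stepsLaw d).real A =
      (2 * (d : ℝ))⁻¹ * ∑ p : Fin d × Bool, (stepsLaw d).real {ξ | consStep (unitStep p) ξ ∈ A} := by
  have h : stepsLaw d A =
      ∑ p : Fin d × Bool, (2 * (d : ENNReal))⁻¹ * stepsLaw d {ξ | consStep (unitStep p) ξ ∈ A} := by
    conv_lhs => rw [← map_consStep d]
    rw [Measure.map_apply measurable_consStep hA,
      Measure.prod_apply (measurable_consStep hA)]
    simp only [stepLaw, lintegral_finsetSum_measure, lintegral_smul_measure, lintegral_dirac]
    rfl
  rw [Measure.real, h, ENNReal.toReal_sum, Finset.mul_sum]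
  · refine Finset.sum_congr rfl fun p _ => ?_
    simp [Measure.real]
  · intro p _
    refine ENNReal.mul_ne_top ?_ (measure_ne_top _ _)
    simp [NeZero.ne d]

theorem iIndepFun_curry {ι κ Ω 𝓧 : Type*} [MeasurableSpace Ω] [MeasurableSpace 𝓧]
    {μ : Measure Ω} [IsProbabilityMeasure μ] {X : ι × κ → Ω → 𝓧} (mX : ∀ p, Measurable (X p))
    (h : iIndepFun X μ) : iIndepFun (fun i ω j => X (i, j) ω) μ := by
  have hp : ∀ p, IsProbabilityMeasure (μ.map (X p)) :=
    fun p => Measure.isProbabilityMeasure_map (mX p).aemeasurable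
  have hm : ∀ i, Measurable fun ω j => X (i, j) ω := fun i => by fun_prop
  have h1 := (iIndepFun_iff_map_fun_eq_infinitePi_map mX).1 h
  rw [iIndepFun_iff_map_fun_eq_infinitePi_map hm]
  have h2 : (fun ω i j => X (i, j) ω) = (MeasurableEquiv.curry ι κ 𝓧) ∘ fun ω p => X p ω := by
    ext; simp
  have h3 : ∀ i, μ.map (fun ω j => X (i, j) ω) = Measure.infinitePi fun j => μ.map (X (i, j)) := by
    intro i
    refine (iIndepFun_iff_map_fun_eq_infinitePi_map (fun j => mX (i, j))).1 ?_
    exact h.precomp (g := fun j => (i, j)) fun a b hab => (Prod.ext_iff.1 hab).2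
  rw [h2, ← Measure.map_map (by fun_prop) (by fun_prop), h1]
  simp_rw [h3]
  exact Measure.infinitePi_map_curry fun i j => μ.map (X (i, j))

/-- The increments of the `i`-th walk. -/
def increments {Ω : Type*} {d : ℕ} (S : ℕ → ℕ → Ω → (Fin d → ℤ)) (i : ℕ) (ω : Ω) :
    ℕ → Fin d → ℤ := fun t => S i (t + 1) ω - S i t ω

/-- The path started at `x` with the given steps. -/
def walkPath {d : ℕ} (x : Fin d → ℤ) (ξ : ℕ → Fin d → ℤ) : ℕ → (Fin d → ℤ)
  | 0 => x
  | t + 1 => walkPath x ξ t + ξ t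

theorem walkPath_consStep_succ {d : ℕ} (x e : Fin d → ℤ) (ξ : ℕ → Fin d → ℤ) (t : ℕ) :
    walkPath x (consStep e ξ) (t + 1) = walkPath (x + e) ξ t := by
  induction t with
  | zero => rfl
  | succ t ih => rw [walkPath, ih]; rfl

theorem measurable_walkPath {d : ℕ} (x : Fin d → ℤ) (t : ℕ) :
    Measurable fun ξ : ℕ → Fin d → ℤ => walkPath x ξ t := by
  induction t with
  | zero => exact measurable_const
  | succ t ih => exact ih.add (measurable_pi_apply t)

namespace AreIndepSimpleRandomWalks

variable {Ω : Type*} [MeasurableSpace Ω] {μ : Measure Ω} {d : ℕ} {S : ℕ → ℕ → Ω → (Fin d → ℤ)}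

theorem measurable_increments (hS : AreIndepSimpleRandomWalks μ S) (i : ℕ) :
    Measurable (increments S i) :=
  measurable_pi_iff.2 fun t => (hS.measurable i (t + 1)).sub (hS.measurable i t)

theorem eq_walkPath (hS : AreIndepSimpleRandomWalks μ S) (i t : ℕ) (ω : Ω) :
    S i t ω = walkPath 0 (increments S i ω) t := by
  induction t with
  | zero => exact hS.start i ω
  | succ t ih => rw [walkPath, ← ih, increments]; abel

theorem iIndepFun_increments [IsProbabilityMeasure μ] (hS : AreIndepSimpleRandomWalks μ S) :
    iIndepFun (increments S) μ :=
  iIndepFun_curry (fun p => (hS.measurable p.1 (p.2 + 1)).sub (hS.measurable p.1 p.2)) hS.indep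

theorem map_increments [IsProbabilityMeasure μ] [NeZero d] (hS : AreIndepSimpleRandomWalks μ S) (i : ℕ) :
    μ.map (increments S i) = stepsLaw d := by
  have hm : ∀ t, Measurable fun ω => S i (t + 1) ω - S i t ω :=
    fun t => (hS.measurable i (t + 1)).sub (hS.measurable i t)
  have h := hS.indep.precomp (g := fun t => (i, t)) fun a b hab => (Prod.ext_iff.1 hab).2
  refine ((iIndepFun_iff_map_fun_eq_infinitePi_map hm).1 h).trans ?_
  rw [stepsLaw]
  congr 1
  funext t
  have := Measure.isProbabilityMeasure_map (μ := μ) (hm t).aemeasurable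
  refine eq_stepLaw _ fun p => ?_
  rw [Measure.map_apply (hm t) (measurableSet_singleton _)]
  exact hS.step i t _ (latticeNorm_unitStep p)

end AreIndepSimpleRandomWalks

end InternalDLA

/-! ### Maximum principle and hitting probabilities. -/

namespace InternalDLA

variable {d : ℕ}

/-- Discrete maximum principle. Ties between maximizers are broken by the first coordinate, so no
connectedness of `R` is needed. -/
theorem subharmonic_nonpos [NeZero d] {R : Set (Fin d → ℤ)} (hR : R.Finite)
    {φ : (Fin d → ℤ) → ℝ} (hφ : ∀ x ∈ R, φ x ≤ neighborAverage φ x)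
    (hb : ∀ x ∈ R, ∀ p, x + unitStep p ∉ R → φ (x + unitStep p) ≤ 0) :
    ∀ x ∈ R, φ x ≤ 0 := by
  by_contra! hcon
  obtain ⟨x₀, hx₀, hpos₀⟩ := hcon
  obtain ⟨x, hx, hmax⟩ := hR.toFinset.exists_max_image
    (fun x => toLex (φ x, x 0)) ⟨x₀, hR.mem_toFinset.2 hx₀⟩
  have hx : x ∈ R := hR.mem_toFinset.1 hx
  have hmax : ∀ y ∈ R, φ y < φ x ∨ φ y = φ x ∧ y 0 ≤ x 0 := fun y hy => by
    simpa [Prod.Lex.toLex_le_toLex] using hmax y (hR.mem_toFinset.2 hy)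
  have hpos : 0 < φ x := by
    rcases hmax x₀ hx₀ with h | h
    · exact hpos₀.trans h
    · exact h.1 ▸ hpos₀
  have hle : ∀ p, φ (x + unitStep p) ≤ φ x := fun p => by
    by_cases h : x + unitStep p ∈ R
    · rcases hmax _ h with h | h
      · exact h.le
      · exact h.1.le
    · exact (hb x hx p h).trans hpos.le
  -- The neighbour in the first coordinate direction is either outside `R`, where `φ ≤ 0 < φ x`, or
  -- would beat `x` in the lexicographic order if it had the same value.
  have hlt : φ (x + unitStep (0, true)) < φ x := by
    by_cases h : x + unitStep (0, true) ∈ R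
    · rcases hmax _ h with h | h
      · exact h
      · have := h.2
        simp [unitStep] at this
    · exact (hb x hx _ h).trans_lt hpos
  have hsum : ∑ p : Fin d × Bool, φ (x + unitStep p) < ∑ _p : Fin d × Bool, φ x :=
    Finset.sum_lt_sum (fun p _ => hle p) ⟨_, Finset.mem_univ _, hlt⟩
  have hd : (0 : ℝ) < 2 * d := by
    have : 0 < d := NeZero.pos d
    positivity
  have h1 := hφ x hx
  rw [neighborAverage, inv_mul_eq_div, le_div_iff₀ hd] at h1
  simp only [Finset.sum_const, Finset.card_univ, Fintype.card_prod, Fintype.card_fin,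
    Fintype.card_bool, nsmul_eq_mul, Nat.cast_mul, Nat.cast_ofNat] at hsum
  linarith

/-- The walk started at `x` visits `y` and is in `R` up to that time, and the sequence of its
subsequent steps is in `B`. -/
def HitsThen (R : Set (Fin d → ℤ)) (y : Fin d → ℤ) (B : Set (ℕ → Fin d → ℤ)) (x : Fin d → ℤ)
    (ξ : ℕ → Fin d → ℤ) : Prop :=
  ∃ t, walkPath x ξ t = y ∧ (∀ r < t, walkPath x ξ r ∈ R) ∧ (fun s => ξ (t + s)) ∈ B

theorem measurableSet_hitsThen (R : Set (Fin d → ℤ)) (y : Fin d → ℤ)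
    {B : Set (ℕ → Fin d → ℤ)} (hB : MeasurableSet B) (x : Fin d → ℤ) :
    MeasurableSet {ξ | HitsThen R y B x ξ} := by
  have : {ξ | HitsThen R y B x ξ} = ⋃ t, ((fun ξ => walkPath x ξ t) ⁻¹' {y} ∩
      ((⋂ r, ⋂ (_ : r < t), (fun ξ => walkPath x ξ r) ⁻¹' R) ∩
        (fun (ξ : ℕ → Fin d → ℤ) s => ξ (t + s)) ⁻¹' B)) := by
    ext ξ
    simp [HitsThen]
  rw [this]
  refine MeasurableSet.iUnion fun t => ?_
  refine (measurable_walkPath x t (measurableSet_singleton y)).inter (MeasurableSet.inter ?_ ?_)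
  · exact .iInter fun r => .iInter fun _ => measurable_walkPath x r (Set.to_countable R).measurableSet
  · exact (measurable_pi_iff.2 fun s => measurable_pi_apply (t + s)) hB

theorem hitsThen_consStep_iff {R : Set (Fin d → ℤ)} {y : Fin d → ℤ} {B : Set (ℕ → Fin d → ℤ)}
    {x e : Fin d → ℤ} {ξ : ℕ → Fin d → ℤ} :
    HitsThen R y B x (consStep e ξ) ↔
      (x = y ∧ consStep e ξ ∈ B) ∨ (x ∈ R ∧ HitsThen R y B (x + e) ξ) := by
  constructor
  · rintro ⟨t, h1, h2, h3⟩
    cases t with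
    | zero => exact .inl ⟨h1, by simpa using h3⟩
    | succ t =>
      refine .inr ⟨h2 0 (by lia), t, ?_, fun r hr => ?_, ?_⟩
      · rwa [walkPath_consStep_succ] at h1
      · have := h2 (r + 1) (by lia)
        rwa [walkPath_consStep_succ] at this
      · have : (fun s => consStep e ξ (t + 1 + s)) = fun s => ξ (t + s) := by
          funext s
          rw [show t + 1 + s = (t + s) + 1 by lia]
          rfl
        rwa [this] at h3
  · rintro (⟨h1, h2⟩ | ⟨h1, t, h2, h3, h4⟩)
    · exact ⟨0, h1, by simp, by simpa using h2⟩
    · refine ⟨t + 1, ?_, fun r hr => ?_, ?_⟩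
      · rwa [walkPath_consStep_succ]
      · cases r with
        | zero => exact h1
        | succ r =>
          rw [walkPath_consStep_succ]
          exact h3 r (by lia)
      · have : (fun s => consStep e ξ (t + 1 + s)) = fun s => ξ (t + s) := by
          funext s
          rw [show t + 1 + s = (t + s) + 1 by lia]
          rfl
        rwa [this]

theorem neighborAverage_sub (f g : (Fin d → ℤ) → ℝ) (x : Fin d → ℤ) :
    neighborAverage (fun x => f x - g x) x = neighborAverage f x - neighborAverage g x := by
  simp [neighborAverage, Finset.sum_sub_distrib, mul_sub]

theorem neighborAverage_mul_const (f : (Fin d → ℤ) → ℝ) (c : ℝ) (x : Fin d → ℤ) :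
    neighborAverage (fun x => f x * c) x = neighborAverage f x * c := by
  simp [neighborAverage, Finset.sum_mul, mul_assoc]

variable [NeZero d]

theorem neighborAverage_hitsThen_le (R : Set (Fin d → ℤ)) (y : Fin d → ℤ)
    {B : Set (ℕ → Fin d → ℤ)} (hB : MeasurableSet B) {x : Fin d → ℤ} (hx : x ∈ R) :
    neighborAverage (fun x => (stepsLaw d).real {ξ | HitsThen R y B x ξ}) x ≤
      (stepsLaw d).real {ξ | HitsThen R y B x ξ} := by
  rw [stepsLaw_real_eq_sum (measurableSet_hitsThen R y hB x), neighborAverage]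
  refine mul_le_mul_of_nonneg_left (Finset.sum_le_sum fun p _ => ?_) (by positivity)
  refine measureReal_mono fun ξ hξ => ?_
  exact hitsThen_consStep_iff.2 (.inr ⟨hx, hξ⟩)

theorem le_hitsThen_self (R : Set (Fin d → ℤ)) (y : Fin d → ℤ) (B : Set (ℕ → Fin d → ℤ)) :
    (stepsLaw d).real B ≤ (stepsLaw d).real {ξ | HitsThen R y B y ξ} :=
  measureReal_mono fun ξ hξ => ⟨0, rfl, by simp, by simpa using hξ⟩

/-- The probability that simple random walk started at `x` visits `y` and is in `R` up to that
time. -/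
noncomputable def hitProb (R : Set (Fin d → ℤ)) (y x : Fin d → ℤ) : ℝ :=
  (stepsLaw d).real {ξ | HitsThen R y Set.univ x ξ}

theorem hitProb_nonneg (R : Set (Fin d → ℤ)) (y x : Fin d → ℤ) : 0 ≤ hitProb R y x :=
  measureReal_nonneg

theorem hitProb_le_one (R : Set (Fin d → ℤ)) (y x : Fin d → ℤ) : hitProb R y x ≤ 1 :=
  measureReal_le_one

theorem hitProb_self (R : Set (Fin d → ℤ)) (y : Fin d → ℤ) : hitProb R y y = 1 := by
  refine le_antisymm (hitProb_le_one _ _ _) ?_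
  have := le_hitsThen_self R y Set.univ
  rwa [probReal_univ] at this

theorem neighborAverage_hitProb_le {R : Set (Fin d → ℤ)} (y : Fin d → ℤ) {x : Fin d → ℤ}
    (hx : x ∈ R) : neighborAverage (hitProb R y) x ≤ hitProb R y x :=
  neighborAverage_hitsThen_le R y .univ hx

theorem hitProb_eq_neighborAverage {R : Set (Fin d → ℤ)} {y x : Fin d → ℤ}
    (hx : x ∈ R) (hxy : x ≠ y) : hitProb R y x = neighborAverage (hitProb R y) x := by
  rw [hitProb, stepsLaw_real_eq_sum (measurableSet_hitsThen R y .univ x), neighborAverage]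
  simp only [Set.mem_ofPred_eq, hitsThen_consStep_iff, hxy, hx, false_and, true_and, false_or]
  rfl

theorem hitProb_eq_zero {R : Set (Fin d → ℤ)} {y x : Fin d → ℤ}
    (hx : x ∉ R) (hxy : x ≠ y) : hitProb R y x = 0 := by
  have : {ξ | HitsThen R y Set.univ x ξ} = ∅ := by
    refine Set.eq_empty_iff_forall_notMem.2 ?_
    rintro ξ ⟨t, h1, h2, -⟩
    cases t with
    | zero => exact hxy h1
    | succ t => exact hx (h2 0 (by lia))
  rw [hitProb, this, measureReal_empty]

/-- `hitProb R y` is the least nonnegative function superharmonic on `R` with value at least one at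
`y`. This comparison replaces the strong Markov property in what follows. -/
theorem hitProb_mul_le {R : Set (Fin d → ℤ)} (hR : R.Finite) (y : Fin d → ℤ)
    {c : ℝ} {g : (Fin d → ℤ) → ℝ} (hg : ∀ x ∈ R, neighborAverage g x ≤ g x)
    (hg0 : ∀ x, 0 ≤ g x) (hy : c ≤ g y) (x : Fin d → ℤ) : hitProb R y x * c ≤ g x := by
  have hout : ∀ x, x ∉ R \ {y} → hitProb R y x * c - g x ≤ 0 := fun x hx => by
    by_cases hxy : x = y
    · subst hxy
      rw [hitProb_self]
      linarith
    · rw [hitProb_eq_zero (fun h => hx ⟨h, hxy⟩) hxy]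
      linarith [hg0 x]
  have := subharmonic_nonpos (hR.sdiff (t := {y})) (φ := fun x => hitProb R y x * c - g x)
    (fun x hx => by
      rw [neighborAverage_sub, neighborAverage_mul_const,
        ← hitProb_eq_neighborAverage hx.1 hx.2]
      linarith [hg x hx.1])
    (fun x _ p hp => hout _ hp)
  by_cases hx : x ∈ R \ {y}
  · linarith [this x hx]
  · linarith [hout x hx]

/-- The lower bound of the strong Markov property at a visit to `y`, with no stopping time: the
right side is superharmonic in `x`. -/
theorem hitProb_mul_le_hitsThen {R : Set (Fin d → ℤ)} (hR : R.Finite) (y : Fin d → ℤ)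
    {B : Set (ℕ → Fin d → ℤ)} (hB : MeasurableSet B) (x : Fin d → ℤ) :
    hitProb R y x * (stepsLaw d).real B ≤ (stepsLaw d).real {ξ | HitsThen R y B x ξ} :=
  hitProb_mul_le hR y (g := fun x => (stepsLaw d).real {ξ | HitsThen R y B x ξ})
    (fun _ hx => neighborAverage_hitsThen_le R y hB hx) (fun _ => measureReal_nonneg)
    (le_hitsThen_self R y B) x

theorem hitProb_mul_hitProb_le {R' R : Set (Fin d → ℤ)} (hR : R'.Finite) (hsub : R' ⊆ R)
    (x y z : Fin d → ℤ) : hitProb R' y x * hitProb R z y ≤ hitProb R z x :=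
  hitProb_mul_le hR y (fun _ hx => neighborAverage_hitProb_le z (hsub hx))
    (fun _ => hitProb_nonneg _ _ _) le_rfl x

theorem hitProb_neighbor_le {R : Set (Fin d → ℤ)} {x : Fin d → ℤ} (hx : x ∈ R)
    (p : Fin d × Bool) (y : Fin d → ℤ) :
    (2 * (d : ℝ))⁻¹ * hitProb R y (x + unitStep p) ≤ hitProb R y x := by
  refine le_trans ?_ (neighborAverage_hitProb_le y hx)
  refine mul_le_mul_of_nonneg_left ?_ (by positivity)
  exact Finset.single_le_sum (f := fun p => hitProb R y (x + unitStep p))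
    (fun p _ => hitProb_nonneg _ _ _) (Finset.mem_univ p)

/-- The walk leaves a finite set almost surely; here this is a consequence of the maximum principle
for `1 - ∑ z, hitProb D z`. -/
theorem one_le_sum_hitProb {D : Set (Fin d → ℤ)} (hD : D.Finite) (Z : Finset (Fin d → ℤ))
    (hZ : ∀ x ∈ D, ∀ p, x + unitStep p ∉ D → x + unitStep p ∈ Z) {x : Fin d → ℤ} (hx : x ∈ D) :
    1 ≤ ∑ z ∈ Z, hitProb D z x := by
  have hd : (0 : ℝ) < 2 * d := by
    have : 0 < d := NeZero.pos d
    positivity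
  have := subharmonic_nonpos hD (φ := fun x => 1 - ∑ z ∈ Z, hitProb D z x) (fun x hx => by
      have h1 : neighborAverage (fun _ : Fin d → ℤ => (1 : ℝ)) x = 1 := by
        simp only [neighborAverage, Finset.sum_const, Finset.card_univ, Fintype.card_prod,
          Fintype.card_fin, Fintype.card_bool, nsmul_eq_mul, Nat.cast_mul, Nat.cast_ofNat]
        rw [mul_comm (d : ℝ) 2, mul_one, inv_mul_cancel₀ hd.ne']
      have h2 : neighborAverage (fun x => ∑ z ∈ Z, hitProb D z x) x =
          ∑ z ∈ Z, neighborAverage (hitProb D z) x := by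
        simp only [neighborAverage]
        rw [Finset.sum_comm, Finset.mul_sum]
      rw [neighborAverage_sub, h1, h2]
      have := Finset.sum_le_sum fun z (_ : z ∈ Z) => neighborAverage_hitProb_le z hx
      linarith)
    (fun x hx p hp => by
      have h1 := Finset.single_le_sum (f := fun z => hitProb D z (x + unitStep p))
        (fun z _ => hitProb_nonneg _ _ _) (hZ x hx p hp)
      have h2 : hitProb D (x + unitStep p) (x + unitStep p) = 1 := hitProb_self _ _
      simp only [h2] at h1
      linarith)
  linarith [this x hx]

end InternalDLA

/-! ### Deterministic growth of the cluster, measurability, and the two errors. -/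

namespace InternalDLA

variable {d : ℕ}

theorem cluster_subset_succ (w : ℕ → ℕ → (Fin d → ℤ)) (N : ℕ) :
    cluster w N ⊆ cluster w (N + 1) := Set.subset_union_left

theorem cluster_mono (w : ℕ → ℕ → (Fin d → ℤ)) : Monotone (cluster w) :=
  monotone_nat_of_le_succ (cluster_subset_succ w)

theorem cluster_finite (w : ℕ → ℕ → (Fin d → ℤ)) (N : ℕ) : (cluster w N).Finite := by
  induction N with
  | zero => exact Set.finite_empty
  | succ N ih => exact ih.union (Set.finite_singleton _)

theorem cluster_congr {w w' : ℕ → ℕ → (Fin d → ℤ)} {N : ℕ} (h : ∀ i < N, w i = w' i) :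
    cluster w N = cluster w' N := by
  induction N with
  | zero => rfl
  | succ N ih =>
    rw [cluster, cluster, ih fun i hi => h i (by lia), h N (by lia)]

/-- Either the site was already occupied, or it is the first unoccupied site on the path and the
explorer settles there. -/
theorem mem_cluster_succ {w : ℕ → ℕ → (Fin d → ℤ)} {N t : ℕ}
    (h : ∀ r < t, w N r ∈ cluster w N) : w N t ∈ cluster w (N + 1) := by
  by_cases hy : w N t ∈ cluster w N
  · exact cluster_subset_succ w N hy
  · refine .inr ?_
    have : settlingTime (w N) (cluster w N) = t := by
      refine le_antisymm (Nat.sInf_le hy) ?_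
      by_contra hlt
      exact Nat.sInf_mem (s := {t | w N t ∉ cluster w N}) ⟨t, hy⟩ (h _ (not_le.1 hlt))
    rw [this]
    rfl

/-- Only inclusions matter: other explorers can merely enlarge the cluster, so one suitable explorer
per block fills the sites `t 0, t 1, …` in turn. -/
theorem mem_cluster_of_blocks {w : ℕ → ℕ → (Fin d → ℤ)} {N K : ℕ} {D : Set (Fin d → ℤ)}
    (hD : D ⊆ cluster w N) (t : ℕ → Fin d → ℤ) {J : ℕ}
    (h : ∀ j < J, ∃ k < K, ∃ τ, w (N + (j * K + k)) τ = t j ∧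
      ∀ r < τ, w (N + (j * K + k)) r ∈ D ∪ t '' {i | i < j}) :
    ∀ j ≤ J, ∀ i < j, t i ∈ cluster w (N + j * K) := by
  intro j
  induction j with
  | zero => intro _ i hi; lia
  | succ j ih =>
    intro hj i hi
    have ih := ih (by lia)
    rcases Nat.lt_succ_iff_lt_or_eq.1 hi with hi | rfl
    · exact cluster_mono w (by gcongr; lia) (ih i hi)
    · obtain ⟨k, hk, τ, h1, h2⟩ := h i (by lia)
      rw [← h1]
      refine cluster_mono w ?_ (mem_cluster_succ (t := τ) fun r hr => ?_)
      · have : (i + 1) * K = i * K + K := by ring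
        lia
      · rcases h2 r hr with h3 | ⟨i', hi', h3⟩
        · exact cluster_mono w (by lia) (hD h3)
        · rw [← h3]
          exact cluster_mono w (by lia) (ih i' hi')

theorem walkPath_add (x : Fin d → ℤ) (ξ : ℕ → Fin d → ℤ) (s r : ℕ) :
    walkPath x ξ (s + r) = walkPath (walkPath x ξ s) (fun u => ξ (s + u)) r := by
  induction r with
  | zero => rfl
  | succ r ih => rw [← add_assoc, walkPath, ih, walkPath]

theorem exists_time_of_hitsThen {D R : Set (Fin d → ℤ)} {x y z : Fin d → ℤ}
    {ξ : ℕ → Fin d → ℤ} (h : HitsThen D z {ξ | HitsThen R y Set.univ z ξ} x ξ) :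
    ∃ τ, walkPath x ξ τ = y ∧ ∀ r < τ, walkPath x ξ r ∈ D ∪ R := by
  obtain ⟨s, h1, h2, t, h3, h4, -⟩ := h
  refine ⟨s + t, ?_, fun r hr => ?_⟩
  · rw [walkPath_add, h1, h3]
  · by_cases hrs : r < s
    · exact .inl (h2 r hrs)
    · obtain ⟨u, rfl⟩ := Nat.exists_eq_add_of_le (not_lt.1 hrs)
      rw [walkPath_add, h1]
      exact .inr (h4 u (by lia))

theorem hitsThen_unique {D : Set (Fin d → ℤ)} {x z z' : Fin d → ℤ} {B B' : Set (ℕ → Fin d → ℤ)}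
    {ξ : ℕ → Fin d → ℤ} (hz : z ∉ D) (hz' : z' ∉ D) (h : HitsThen D z B x ξ)
    (h' : HitsThen D z' B' x ξ) : z = z' := by
  obtain ⟨t, h1, h2, -⟩ := h
  obtain ⟨t', h1', h2', -⟩ := h'
  rcases lt_trichotomy t t' with hlt | rfl | hlt
  · exact absurd (h1 ▸ h2' t hlt) hz
  · rw [← h1, ← h1']
  · exact absurd (h1' ▸ h2 t' hlt) hz'

theorem measurableSet_settlingTime_eq (i m : ℕ) (A : Set (Fin d → ℤ)) :
    MeasurableSet {w : ℕ → ℕ → (Fin d → ℤ) | settlingTime (w i) A = m} := by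
  have hev : ∀ t, MeasurableSet {w : ℕ → ℕ → (Fin d → ℤ) | w i t ∈ A} := fun t =>
    ((measurable_pi_apply t).comp (measurable_pi_apply i)) (Set.to_countable A).measurableSet
  have : {w : ℕ → ℕ → (Fin d → ℤ) | settlingTime (w i) A = m} =
      -- The second piece of the union accounts for paths that never leave `A`, whose settling time
      -- is `0` by the convention on `sInf ∅`.
      ({w | w i m ∈ A}ᶜ ∩ ⋂ r, ⋂ (_ : r < m), {w | w i r ∈ A}) ∪
        ({_w | m = 0} ∩ ⋂ t, {w | w i t ∈ A}) := by
    ext w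
    simp only [Set.mem_ofPred_eq, Set.mem_union, Set.mem_inter_iff, Set.mem_compl_iff,
      Set.mem_iInter]
    constructor
    · rintro rfl
      by_cases hne : {t | w i t ∉ A}.Nonempty
      · refine .inl ⟨Nat.sInf_mem hne, fun r hr => ?_⟩
        by_contra hcon
        exact absurd (Nat.sInf_le (s := {t | w i t ∉ A}) hcon) (not_le.2 hr)
      · rw [Set.not_nonempty_iff_eq_empty] at hne
        refine .inr ⟨by rw [settlingTime, hne, Nat.sInf_empty], fun t => ?_⟩
        by_contra hcon
        exact (Set.eq_empty_iff_forall_notMem.1 hne) t hcon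
    · rintro (⟨h1, h2⟩ | ⟨rfl, h2⟩)
      · refine le_antisymm (Nat.sInf_le h1) ?_
        by_contra hlt
        exact Nat.sInf_mem (s := {t | w i t ∉ A}) ⟨m, h1⟩ (h2 _ (not_le.1 hlt))
      · have : {t | w i t ∉ A} = ∅ := Set.eq_empty_iff_forall_notMem.2 fun t ht => ht (h2 t)
        rw [settlingTime, this, Nat.sInf_empty]
  rw [this]
  refine ((hev m).compl.inter (.iInter fun r => .iInter fun _ => hev r)).union
    (MeasurableSet.inter (.const _) (.iInter fun t => hev t))

theorem measurableSet_cluster_eq (N : ℕ) (C : Finset (Fin d → ℤ)) :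
    MeasurableSet {w : ℕ → ℕ → (Fin d → ℤ) | cluster w N = C} := by
  induction N generalizing C with
  | zero => exact MeasurableSet.const ((∅ : Set (Fin d → ℤ)) = C)
  | succ N ih =>
    have : {w : ℕ → ℕ → (Fin d → ℤ) | cluster w (N + 1) = C} =
        ⋃ C' : Finset (Fin d → ℤ), ⋃ m : ℕ, ({w | cluster w N = C'} ∩
          ({w | settlingTime (w N) C' = m} ∩
            (fun w : ℕ → ℕ → (Fin d → ℤ) => w N m) ⁻¹' {y | (C' : Set (Fin d → ℤ)) ∪ {y} = C})) := by
      ext w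
      simp only [Set.mem_iUnion, Set.mem_inter_iff, Set.mem_ofPred_eq, Set.mem_preimage]
      constructor
      · intro h
        refine ⟨(cluster_finite w N).toFinset, _, by simp, rfl, ?_⟩
        simpa [cluster] using h
      · rintro ⟨C', m, h1, rfl, h3⟩
        rw [cluster, h1, h3]
    rw [this]
    refine .iUnion fun C' => .iUnion fun m => (ih C').inter
      ((measurableSet_settlingTime_eq N m _).inter ?_)
    exact ((measurable_pi_apply m).comp (measurable_pi_apply N)) (Set.to_countable _).measurableSet

/-- Clusters are finite, so they take countably many values and any property of them is measurable.
-/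
theorem measurableSet_cluster (N : ℕ) (P : Set (Fin d → ℤ) → Prop) :
    MeasurableSet {w : ℕ → ℕ → (Fin d → ℤ) | P (cluster w N)} := by
  have : {w : ℕ → ℕ → (Fin d → ℤ) | P (cluster w N)} =
      ⋃ C : Finset (Fin d → ℤ), ({w | cluster w N = C} ∩ {_w | P C}) := by
    ext w
    simp only [Set.mem_iUnion, Set.mem_inter_iff, Set.mem_ofPred_eq]
    constructor
    · intro h
      exact ⟨(cluster_finite w N).toFinset, by simp, by simpa using h⟩
    · rintro ⟨C, h1, h2⟩
      rwa [h1]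
  rw [this]
  exact .iUnion fun C => (measurableSet_cluster_eq N C).inter (.const _)

theorem measurableSet_innerError_lt (n : ℕ) (c : ℝ) :
    MeasurableSet {w : ℕ → ℕ → (Fin d → ℤ) | innerError w n < c} :=
  measurableSet_cluster (ballVolume d n)
    fun A => (n : ℝ) - sSup {r : ℝ | 0 ≤ r ∧ latticeBall d r ⊆ A} < c

theorem latticeNorm_sq (z : Fin d → ℤ) : latticeNorm z ^ 2 = ∑ i, (z i : ℝ) ^ 2 := by
  simp [latticeNorm, EuclideanSpace.norm_sq_eq]

theorem latticeNorm_nonneg (z : Fin d → ℤ) : 0 ≤ latticeNorm z := norm_nonneg _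

theorem latticeNorm_lt_iff {z : Fin d → ℤ} {r : ℝ} (hr : 0 ≤ r) :
    latticeNorm z < r ↔ ∑ i, (z i : ℝ) ^ 2 < r ^ 2 := by
  rw [← latticeNorm_sq, sq_lt_sq₀ (latticeNorm_nonneg z) hr]

theorem latticeNorm_add_le (x y : Fin d → ℤ) :
    latticeNorm (x + y) ≤ latticeNorm x + latticeNorm y := by
  have : (WithLp.toLp 2 fun i => (((x + y) i : ℤ) : ℝ) : EuclideanSpace ℝ (Fin d)) =
      WithLp.toLp 2 (fun i => (x i : ℝ)) + WithLp.toLp 2 (fun i => (y i : ℝ)) := by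
    ext i
    simp
  rw [latticeNorm, this]
  exact norm_add_le _ _

theorem latticeNorm_zero : latticeNorm (0 : Fin d → ℤ) = 0 := by
  have := latticeNorm_sq (0 : Fin d → ℤ)
  simpa using this

theorem bddAbove_radii [NeZero d] {A : Set (Fin d → ℤ)} (hA : A.Finite) :
    BddAbove {r : ℝ | 0 ≤ r ∧ latticeBall d r ⊆ A} := by
  by_contra hcon
  have hall : ∀ z : Fin d → ℤ, z ∈ A := fun z => by
    obtain ⟨r, hr, h⟩ := not_bddAbove_iff.1 hcon (latticeNorm z)
    exact hr.2 h
  exact Set.infinite_univ (hA.subset fun z _ => hall z)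

theorem innerError_nonpos_of_subset [NeZero d] {w : ℕ → ℕ → (Fin d → ℤ)} {n : ℕ}
    (h : latticeBall d n ⊆ cluster w (ballVolume d n)) : innerError w n ≤ 0 := by
  have := le_csSup (bddAbove_radii (cluster_finite w (ballVolume d n)))
    (show (n : ℝ) ∈ _ from ⟨Nat.cast_nonneg n, h⟩)
  rw [innerError]
  linarith

theorem latticeBall_subset_of_innerError_lt [NeZero d] {w : ℕ → ℕ → (Fin d → ℤ)} {n : ℕ} {c : ℝ}
    (h : innerError w n < c) : latticeBall d (n - c) ⊆ cluster w (ballVolume d n) := by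
  rw [innerError, sub_lt_comm] at h
  obtain ⟨r, ⟨hr0, hr⟩, hlt⟩ := exists_lt_of_lt_csSup
    (s := {r : ℝ | 0 ≤ r ∧ latticeBall d r ⊆ cluster w (ballVolume d n)})
    -- The open ball of radius zero is empty, so the set of admissible radii is never empty.
    ⟨0, le_rfl, fun z hz => absurd hz (not_lt.2 (latticeNorm_nonneg z))⟩ h
  exact fun z hz => hr (lt_trans hz hlt)

theorem le_outerError {w : ℕ → ℕ → (Fin d → ℤ)} {n : ℕ} {c : ℝ} {y : Fin d → ℤ}
    (hy : y ∈ cluster w (ballVolume d n)) (hc : n + c ≤ latticeNorm y) : c ≤ outerError w n := by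
  have hne : {r : ℝ | 0 ≤ r ∧ cluster w (ballVolume d n) ⊆ latticeBall d r}.Nonempty := by
    obtain ⟨M, hM⟩ := ((cluster_finite w (ballVolume d n)).image latticeNorm).bddAbove
    refine ⟨|M| + 1, by positivity, fun z hz => ?_⟩
    have := hM ⟨z, hz, rfl⟩
    exact lt_of_le_of_lt (this.trans (le_abs_self M)) (lt_add_one _)
  have : n + c ≤ sInf {r : ℝ | 0 ≤ r ∧ cluster w (ballVolume d n) ⊆ latticeBall d r} :=
    le_csInf hne fun r hr => hc.trans (hr.2 hy).le
  rw [outerError]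
  linarith

/-- Along a lattice path from `0` to `y` that moves each coordinate monotonically, the norm stays
below that of `y` until arrival, so the path is in `R`. -/
theorem hitProb_zero_pos [NeZero d] {R : Set (Fin d → ℤ)} {y : Fin d → ℤ}
    (hR : ∀ x, latticeNorm x < latticeNorm y → x ∈ R) : 0 < hitProb R y 0 := by
  have hd : (0 : ℝ) < 2 * d := by
    have : 0 < d := NeZero.pos d
    positivity
  -- The sign condition says that `x i` lies between `0` and `y i`; `m` is the remaining `ℓ¹`
  -- distance.
  suffices h : ∀ m : ℕ, ∀ x : Fin d → ℤ, (∀ i, 0 ≤ x i * (y i - x i)) →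
      ∑ i, (y i - x i).natAbs = m → 0 < hitProb R y x from h _ 0 (by simp) rfl
  intro m
  induction m with
  | zero =>
    intro x _ hm
    have : x = y := by
      funext i
      have := (Finset.sum_eq_zero_iff.1 hm) i (Finset.mem_univ i)
      lia
    rw [this, hitProb_self]
    exact one_pos
  | succ m ih =>
    intro x hx hm
    obtain ⟨i, -, hi⟩ : ∃ i ∈ Finset.univ, (y i - x i).natAbs ≠ 0 := by
      by_contra! hcon
      rw [Finset.sum_eq_zero hcon] at hm
      lia
    have hi : y i - x i ≠ 0 := by lia
    have hxR : x ∈ R := by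
      refine hR x ((latticeNorm_lt_iff (latticeNorm_nonneg y)).2 ?_)
      rw [latticeNorm_sq]
      refine Finset.sum_lt_sum (fun j _ => ?_) ⟨i, Finset.mem_univ i, ?_⟩
      · have h1 := hx j
        have : x j ^ 2 ≤ y j ^ 2 := by nlinarith [sq_nonneg (y j - x j)]
        exact_mod_cast this
      · have h1 := hx i
        have : x i ^ 2 < y i ^ 2 := by nlinarith [sq_pos_of_ne_zero hi]
        exact_mod_cast this
    have hs : ∀ b : Bool, (x + unitStep (i, b)) = Function.update x i (x i + if b then 1 else -1) := by
      intro b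
      funext j
      by_cases hj : j = i
      · subst hj; simp [unitStep]
      · simp [unitStep, hj]
    obtain ⟨b, hb1, hb2⟩ : ∃ b : Bool,
        0 ≤ (x i + if b then 1 else -1) * (y i - (x i + if b then 1 else -1)) ∧
        (y i - (x i + if b then 1 else -1)).natAbs + 1 = (y i - x i).natAbs := by
      have h1 := hx i
      rcases lt_or_gt_of_ne hi with hlt | hgt
      · refine ⟨false, ?_, by simp; lia⟩
        have : x i ≤ 0 := by nlinarith
        simp only [Bool.false_eq_true, if_false]
        nlinarith
      · refine ⟨true, ?_, by simp; lia⟩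
        have : 0 ≤ x i := by nlinarith
        simp only [if_true]
        nlinarith
    refine lt_of_lt_of_le ?_ (hitProb_neighbor_le hxR (i, b) y)
    refine mul_pos (inv_pos.2 hd) (ih _ (fun j => ?_) ?_)
    · rw [hs]
      by_cases hj : j = i
      · subst hj; simpa using hb1
      · simpa [hj] using hx j
    · rw [hs]
      rw [← Finset.add_sum_erase _ _ (Finset.mem_univ i)] at hm ⊢
      rw [Finset.sum_congr rfl (g := fun j => (y j - x j).natAbs) fun j hj => by
        simp [(Finset.mem_erase.1 hj).1]]
      simp only [Function.update_self]
      lia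

end InternalDLA

/-! ### Second moment method and blocks of independent trials. -/

namespace InternalDLA

/-- Second moment bound: events with nonpositive pairwise correlations. -/
theorem measureReal_iInter_compl_le {Ω ι : Type*} [MeasurableSpace Ω] {μ : Measure Ω}
    [IsProbabilityMeasure μ] (Z : Finset ι) {F : ι → Set Ω} (hF : ∀ z ∈ Z, MeasurableSet (F z))
    (hneg : ∀ z ∈ Z, ∀ z' ∈ Z, z ≠ z' → μ.real (F z ∩ F z') ≤ μ.real (F z) * μ.real (F z'))
    (hpos : 0 < ∑ z ∈ Z, μ.real (F z)) :
    μ.real (⋂ z ∈ Z, (F z)ᶜ) ≤ (∑ z ∈ Z, μ.real (F z))⁻¹ := by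
  classical
  set s := ∑ z ∈ Z, μ.real (F z) with hs
  set X : Ω → ℝ := fun ω => ∑ z ∈ Z, (F z).indicator 1 ω with hX
  have hint : ∀ A : Set Ω, MeasurableSet A → Integrable (A.indicator (1 : Ω → ℝ)) μ := fun A hA =>
    (integrable_const (1 : ℝ)).indicator hA
  have hXi : Integrable X μ := integrable_finsetSum _ fun z hz => hint _ (hF z hz)
  have hX1 : ∫ ω, X ω ∂μ = s := by
    rw [integral_finsetSum _ fun z hz => hint _ (hF z hz)]
    exact Finset.sum_congr rfl fun z hz => integral_indicator_one (hF z hz)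
  have hXsq : ∀ ω, X ω ^ 2 = ∑ z ∈ Z, ∑ z' ∈ Z, (F z ∩ F z').indicator (1 : Ω → ℝ) ω := fun ω => by
    rw [sq, hX, Finset.sum_mul_sum]
    refine Finset.sum_congr rfl fun z _ => Finset.sum_congr rfl fun z' _ => ?_
    rw [Set.inter_indicator_one]
    rfl
  have hX2i : Integrable (fun ω => X ω ^ 2) μ := by
    simp_rw [hXsq]
    exact integrable_finsetSum _ fun z hz => integrable_finsetSum _ fun z' hz' =>
      hint _ ((hF z hz).inter (hF z' hz'))
  have hX2 : ∫ ω, X ω ^ 2 ∂μ ≤ s + s ^ 2 := by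
    simp_rw [hXsq]
    rw [integral_finsetSum _ fun z hz => integrable_finsetSum _ fun z' hz' =>
      hint _ ((hF z hz).inter (hF z' hz'))]
    have : ∀ z ∈ Z, ∫ ω, ∑ z' ∈ Z, (F z ∩ F z').indicator (1 : Ω → ℝ) ω ∂μ ≤
        μ.real (F z) + μ.real (F z) * s := fun z hz => by
      rw [integral_finsetSum _ fun z' hz' => hint _ ((hF z hz).inter (hF z' hz')),
        Finset.sum_congr rfl fun z' hz' => integral_indicator_one ((hF z hz).inter (hF z' hz')),
        ← Finset.add_sum_erase _ _ hz, Set.inter_self, hs, Finset.mul_sum]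
      gcongr
      refine (Finset.sum_le_sum fun z' hz' => hneg z hz z' (Finset.mem_of_mem_erase hz')
        (Finset.ne_of_mem_erase hz').symm).trans ?_
      exact Finset.sum_le_sum_of_subset_of_nonneg (Finset.erase_subset _ _)
        fun _ _ _ => mul_nonneg measureReal_nonneg measureReal_nonneg
    refine (Finset.sum_le_sum this).trans (le_of_eq ?_)
    rw [Finset.sum_add_distrib, ← Finset.sum_mul, ← hs]
    ring
  set A := ⋂ z ∈ Z, (F z)ᶜ with hA
  have hAm : MeasurableSet A := Finset.measurableSet_biInter _ fun z hz => (hF z hz).compl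
  -- Chebyshev's inequality: the right side is `(X - s)²`, which equals `s²` where no event occurs,
  -- and its mean is at most `s`.
  have hpt : ∀ ω, s ^ 2 * A.indicator 1 ω ≤ X ω ^ 2 - 2 * s * X ω + s ^ 2 := fun ω => by
    by_cases hω : ω ∈ A
    · have : X ω = 0 := Finset.sum_eq_zero fun z hz => by
        simp only [hA, Set.mem_iInter] at hω
        exact Set.indicator_of_notMem (hω z hz) _
      simp [this, hω]
    · simp only [hω, not_false_eq_true, Set.indicator_of_notMem, mul_zero]
      nlinarith [sq_nonneg (X ω - s)]
  have hfin := integral_mono ((hint A hAm).const_mul (s ^ 2))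
    ((hX2i.sub (hXi.const_mul (2 * s))).add (integrable_const (s ^ 2))) hpt
  have h3 : ∫ ω, (X ω ^ 2 - 2 * s * X ω + s ^ 2) ∂μ = ∫ ω, X ω ^ 2 ∂μ - 2 * s * s + s ^ 2 := by
    have hsub : Integrable (fun ω => X ω ^ 2 - 2 * s * X ω) μ := hX2i.sub (hXi.const_mul (2 * s))
    rw [integral_add hsub (integrable_const _), integral_sub hX2i (hXi.const_mul (2 * s)), integral_const_mul, hX1]
    simp
  rw [integral_const_mul, integral_indicator_one hAm] at hfin
  have h4 : s ^ 2 * μ.real A ≤ s := by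
    refine hfin.trans ((le_of_eq h3).trans ?_)
    linarith
  rw [← one_div, le_div_iff₀ hpos]
  nlinarith

section Blocks

variable {Ω 𝓧 : Type*} [MeasurableSpace Ω] [MeasurableSpace 𝓧] {μ : Measure Ω}
  {X : ℕ → Ω → 𝓧}

variable {ι : Type*} {J K : ℕ} {A : ι → ℕ → Set 𝓧}

/-- In each of `J` successive blocks of `K` trials starting at `N`, some trial of the `j`-th block
is in `A z j`. -/
def blockSuccess (X : ℕ → Ω → 𝓧) (N J K : ℕ) (A : ι → ℕ → Set 𝓧) (z : ι) : Set Ω :=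
  {ω | ∀ j : Fin J, ∃ k : Fin K, X (N + (j * K + k)) ω ∈ A z j}

/-- The block successes are independent of the first `N` trials. -/
theorem measureReal_inter_blockFailure (hm : ∀ i, Measurable (X i)) (hX : iIndepFun X μ) (N : ℕ)
    (Z : Finset ι) (hA : ∀ z ∈ Z, ∀ j, MeasurableSet (A z j))
    {Γ : Set (Finset.range N → 𝓧)} (hΓ : MeasurableSet Γ) :
    μ.real ((fun ω (i : Finset.range N) => X i ω) ⁻¹' Γ ∩
      ⋂ z ∈ Z, (blockSuccess X N J K A z)ᶜ) =
    μ.real ((fun ω (i : Finset.range N) => X i ω) ⁻¹' Γ) *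
      μ.real (⋂ z ∈ Z, (blockSuccess X N J K A z)ᶜ) := by
  set T := Finset.Ico N (N + J * K) with hT
  have hind := hX.indepFun_finset (Finset.range N) T
    (Finset.disjoint_left.2 fun i hi hi' => by simp [hT] at hi hi'; lia) hm
  have hidx : ∀ (j : Fin J) (k : Fin K), N + ((j : ℕ) * K + k) ∈ T := fun j k => by
    have : ((j : ℕ) + 1) * K ≤ J * K := Nat.mul_le_mul_right K j.2
    have : ((j : ℕ) + 1) * K = j * K + K := by ring
    have := k.2
    simp only [hT, Finset.mem_Ico]
    lia
  have hB : MeasurableSet (⋂ z ∈ Z, {η : T → 𝓧 | ∀ j : Fin J, ∃ k : Fin K,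
      η ⟨_, hidx j k⟩ ∈ A z j}ᶜ) := by
    refine Finset.measurableSet_biInter _ fun z hz => MeasurableSet.compl ?_
    have : {η : T → 𝓧 | ∀ j : Fin J, ∃ k : Fin K, η ⟨_, hidx j k⟩ ∈ A z j} =
        ⋂ j : Fin J, ⋃ k : Fin K, (fun η : T → 𝓧 => η ⟨_, hidx j k⟩) ⁻¹' A z j := by
      ext η
      simp
    rw [this]
    exact .iInter fun j => .iUnion fun k => measurable_pi_apply _ (hA z hz j)
  have := hind.measure_inter_preimage_eq_mul _ _ hΓ hB
  have hset : (fun ω (i : T) => X i ω) ⁻¹' (⋂ z ∈ Z, {η : T → 𝓧 | ∀ j : Fin J, ∃ k : Fin K,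
      η ⟨_, hidx j k⟩ ∈ A z j}ᶜ) = ⋂ z ∈ Z, (blockSuccess X N J K A z)ᶜ := by
    ext ω
    simp [blockSuccess]
  rw [hset] at this
  rw [Measure.real, this, ENNReal.toReal_mul]
  rfl

variable [IsProbabilityMeasure μ] {ν : Measure 𝓧} [IsProbabilityMeasure ν]

theorem measureReal_exists_mem (hm : ∀ i, Measurable (X i)) (hX : iIndepFun X μ)
    (hν : ∀ i, μ.map (X i) = ν) {K : ℕ} {f : Fin K → ℕ} (hf : f.Injective) {A : Set 𝓧}
    (hA : MeasurableSet A) : μ.real {ω | ∃ k, X (f k) ω ∈ A} = 1 - (1 - ν.real A) ^ K := by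
  have h1 : {ω | ∃ k, X (f k) ω ∈ A} = (⋂ k, X (f k) ⁻¹' Aᶜ)ᶜ := by
    ext ω
    simp
  have h2 : μ.real (⋂ k, X (f k) ⁻¹' Aᶜ) = (1 - ν.real A) ^ K := by
    rw [Measure.real, (hX.precomp hf).meas_iInter fun k => ⟨Aᶜ, hA.compl, rfl⟩,
      ENNReal.toReal_prod]
    have : ∀ k, (μ (X (f k) ⁻¹' Aᶜ)).toReal = 1 - ν.real A := fun k => by
      rw [← Measure.map_apply (hm _) hA.compl, hν, ← Measure.real, probReal_compl_eq_one_sub hA]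
    simp only [this, Finset.prod_const, Finset.card_univ, Fintype.card_fin]
  rw [h1, probReal_compl_eq_one_sub (.iInter fun k => hm _ hA.compl), h2]

theorem blockIndex_injective (N : ℕ) :
    Function.Injective fun p : Fin J × Fin K => N + ((p.1 : ℕ) * K + p.2) := by
  rintro ⟨j, k⟩ ⟨j', k'⟩ h
  have h : (j : ℕ) * K + k = j' * K + k' := by simpa using h
  have hK : 0 < K := lt_of_le_of_lt (Nat.zero_le _) k.2
  have h1 := congrArg (· / K) h
  have h2 := congrArg (· % K) h
  simp only [mul_comm _ K, Nat.mul_add_div hK, Nat.div_eq_of_lt k.2,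
    Nat.div_eq_of_lt k'.2, Nat.mul_add_mod, Nat.mod_eq_of_lt k.2, Nat.mod_eq_of_lt k'.2] at h1 h2
  exact Prod.ext (Fin.ext (by simpa using h1)) (Fin.ext h2)

theorem iIndepFun_blocks (hm : ∀ i, Measurable (X i)) (hX : iIndepFun X μ) (N : ℕ) :
    iIndepFun (fun (j : Fin J) ω (k : Fin K) => X (N + (j * K + k)) ω) μ :=
  iIndepFun_curry (X := fun p : Fin J × Fin K => X (N + (p.1 * K + p.2))) (fun _ => hm _)
    (hX.precomp (blockIndex_injective N))

theorem measurableSet_exists_block {B : Set 𝓧} (hB : MeasurableSet B) :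
    MeasurableSet {η : Fin K → 𝓧 | ∃ k, η k ∈ B} := by
  have : {η : Fin K → 𝓧 | ∃ k, η k ∈ B} = ⋃ k, (fun η => η k) ⁻¹' B := by
    ext η
    simp
  rw [this]
  exact .iUnion fun k => measurable_pi_apply k hB

theorem measurableSet_blockSuccess (hm : ∀ i, Measurable (X i)) (N : ℕ) {z : ι}
    (hA : ∀ j, MeasurableSet (A z j)) : MeasurableSet (blockSuccess X N J K A z) := by
  have : blockSuccess X N J K A z =
      ⋂ j : Fin J, ⋃ k : Fin K, X (N + (j * K + k)) ⁻¹' A z j := by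
    ext ω
    simp [blockSuccess]
  rw [this]
  exact .iInter fun j => .iUnion fun k => hm _ (hA j)

theorem measureReal_blockSuccess (hm : ∀ i, Measurable (X i)) (hX : iIndepFun X μ)
    (hν : ∀ i, μ.map (X i) = ν) (N : ℕ) {z : ι} (hA : ∀ j, MeasurableSet (A z j)) :
    μ.real (blockSuccess X N J K A z) = ∏ j : Fin J, (1 - (1 - ν.real (A z j)) ^ K) := by
  have : blockSuccess X N J K A z =
      ⋂ j : Fin J, (fun ω (k : Fin K) => X (N + (j * K + k)) ω) ⁻¹' {η | ∃ k, η k ∈ A z j} := by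
    ext ω
    simp [blockSuccess]
  rw [this, Measure.real, (iIndepFun_blocks hm hX N).meas_iInter
    fun j => ⟨_, measurableSet_exists_block (hA j), rfl⟩, ENNReal.toReal_prod]
  refine Finset.prod_congr rfl fun j _ => ?_
  rw [← measureReal_exists_mem hm hX hν (f := fun k : Fin K => N + (j * K + k))
    (fun a b h => by simpa [Fin.ext_iff] using h) (hA j)]
  rfl

/-- A single trial cannot serve both `z` and `z'`. Within a block, inclusion-exclusion reduces the
claim to `(1 - a - b)^K ≤ (1 - a)^K (1 - b)^K`; distinct blocks are independent. -/
theorem measureReal_blockSuccess_inter_le (hm : ∀ i, Measurable (X i)) (hX : iIndepFun X μ)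
    (hν : ∀ i, μ.map (X i) = ν) (N : ℕ) {z z' : ι} (hA : ∀ j, MeasurableSet (A z j))
    (hA' : ∀ j, MeasurableSet (A z' j)) (hdisj : ∀ j, Disjoint (A z j) (A z' j)) :
    μ.real (blockSuccess X N J K A z ∩ blockSuccess X N J K A z') ≤
      μ.real (blockSuccess X N J K A z) * μ.real (blockSuccess X N J K A z') := by
  have : blockSuccess X N J K A z ∩ blockSuccess X N J K A z' =
      ⋂ j : Fin J, (fun ω (k : Fin K) => X (N + (j * K + k)) ω) ⁻¹'
        ({η | ∃ k, η k ∈ A z j} ∩ {η | ∃ k, η k ∈ A z' j}) := by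
    ext ω
    simp [blockSuccess, forall_and]
  rw [measureReal_blockSuccess hm hX hν N hA, measureReal_blockSuccess hm hX hν N hA', this,
    Measure.real, (iIndepFun_blocks hm hX N).meas_iInter
    fun j => ⟨_, (measurableSet_exists_block (hA j)).inter (measurableSet_exists_block (hA' j)), rfl⟩,
    ENNReal.toReal_prod, ← Finset.prod_mul_distrib]
  refine Finset.prod_le_prod (fun _ _ => ENNReal.toReal_nonneg) fun j _ => ?_
  have hf : Function.Injective fun k : Fin K => N + ((j : ℕ) * K + k) :=
    fun a b h => by simpa [Fin.ext_iff] using h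
  have e1 := measureReal_exists_mem hm hX hν hf (hA j)
  have e2 := measureReal_exists_mem hm hX hν hf (hA' j)
  have e3 := measureReal_exists_mem hm hX hν hf ((hA j).union (hA' j))
  rw [measureReal_union (hdisj j) (hA' j)] at e3
  have hle : ν.real (A z j) + ν.real (A z' j) ≤ 1 := by
    rw [← measureReal_union (hdisj j) (hA' j)]
    exact measureReal_le_one
  have hmeas : MeasurableSet {ω | ∃ k : Fin K, X (N + (j * K + k)) ω ∈ A z' j} := by
    have : {ω | ∃ k : Fin K, X (N + (j * K + k)) ω ∈ A z' j} =
        ⋃ k : Fin K, X (N + (j * K + k)) ⁻¹' A z' j := by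
      ext ω
      simp
    rw [this]
    exact .iUnion fun k => hm _ (hA' j)
  have e4 := measureReal_union_add_inter (μ := μ)
    (s := {ω | ∃ k : Fin K, X (N + (j * K + k)) ω ∈ A z j}) hmeas
  have e5 : {ω | ∃ k : Fin K, X (N + (j * K + k)) ω ∈ A z j} ∪
      {ω | ∃ k : Fin K, X (N + (j * K + k)) ω ∈ A z' j} =
      {ω | ∃ k : Fin K, X (N + (j * K + k)) ω ∈ A z j ∪ A z' j} := by
    ext ω
    simp [exists_or]
  rw [e5, e3, e1, e2] at e4
  set a := ν.real (A z j)
  set b := ν.real (A z' j)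
  have ha : 0 ≤ a := measureReal_nonneg
  have hb : 0 ≤ b := measureReal_nonneg
  have hpow : (1 - (a + b)) ^ K ≤ (1 - a) ^ K * (1 - b) ^ K := by
    rw [← mul_pow]
    exact pow_le_pow_left₀ (by linarith) (by nlinarith) K
  change μ.real ({ω | ∃ k : Fin K, X (N + (j * K + k)) ω ∈ A z j} ∩
      {ω | ∃ k : Fin K, X (N + (j * K + k)) ω ∈ A z' j}) ≤ _
  nlinarith

end Blocks

end InternalDLA

/-! ### Lattice geometry: outward directions and counting sites in shells. -/

namespace InternalDLA

variable {d : ℕ}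

/-- The inner product of `z` with a unit vector. -/
def stepCoord (p : Fin d × Bool) (z : Fin d → ℤ) : ℤ := (if p.2 then 1 else -1) * z p.1

theorem latticeNorm_add_smul_sq (z : Fin d → ℤ) (ℓ : ℕ) (p : Fin d × Bool) :
    latticeNorm (z + ℓ • unitStep p) ^ 2 =
      latticeNorm z ^ 2 + 2 * ℓ * (stepCoord p z : ℝ) + (ℓ : ℝ) ^ 2 := by
  rw [latticeNorm_sq, latticeNorm_sq, ← Finset.add_sum_erase _ _ (Finset.mem_univ p.1),
    ← Finset.add_sum_erase Finset.univ (fun i => (z i : ℝ) ^ 2) (Finset.mem_univ p.1),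
    Finset.sum_congr rfl (g := fun i => (z i : ℝ) ^ 2) fun i hi => by
      simp [unitStep, (Finset.mem_erase.1 hi).1]]
  rcases p with ⟨i, b⟩
  cases b <;> simp [unitStep, stepCoord] <;> ring

theorem latticeNorm_add_smul_le (z : Fin d → ℤ) (ℓ : ℕ) (p : Fin d × Bool) :
    latticeNorm (z + ℓ • unitStep p) ≤ latticeNorm z + ℓ := by
  refine (latticeNorm_add_le _ _).trans ?_
  have := latticeNorm_add_smul_sq 0 ℓ p
  have h0 : stepCoord p 0 = 0 := by simp [stepCoord]
  rw [zero_add, latticeNorm_zero, h0] at this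
  have h : latticeNorm (ℓ • unitStep p) ≤ ℓ := by
    refine (sq_le_sq₀ (latticeNorm_nonneg _) (Nat.cast_nonneg ℓ)).1 ?_
    rw [this]
    simp
  linarith

/-- The direction of the largest coordinate works; the factor `d` is a crude replacement for `√d`.
-/
theorem exists_outwardStep [NeZero d] (z : Fin d → ℤ) :
    ∃ p : Fin d × Bool, latticeNorm z ≤ d * (stepCoord p z : ℝ) := by
  have hd : (1 : ℝ) ≤ d := by
    have : 1 ≤ d := NeZero.one_le
    exact_mod_cast this
  obtain ⟨i, -, hi⟩ := Finset.exists_max_image Finset.univ (fun i => (z i : ℝ) ^ 2)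
    ⟨(0 : Fin d), Finset.mem_univ _⟩
  have hs : latticeNorm z ^ 2 ≤ d * (z i : ℝ) ^ 2 := by
    rw [latticeNorm_sq]
    refine (Finset.sum_le_card_nsmul _ _ _ hi).trans ?_
    simp
  have key : ∀ c : ℝ, 0 ≤ c → c ^ 2 = (z i : ℝ) ^ 2 → latticeNorm z ≤ d * c := fun c hc hcz => by
    refine (sq_le_sq₀ (latticeNorm_nonneg _) (by positivity)).1 (hs.trans ?_)
    rw [← hcz, mul_pow]
    nlinarith [sq_nonneg c, mul_nonneg (sq_nonneg c) (sub_nonneg.2 hd)]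
  rcases le_total 0 (z i) with h | h
  · refine ⟨(i, true), key _ ?_ ?_⟩ <;> simp [stepCoord, h]
  · refine ⟨(i, false), key _ ?_ ?_⟩ <;> simp [stepCoord, h]

/-- A unit vector which makes a small angle with `z`. -/
noncomputable def outwardStep [NeZero d] (z : Fin d → ℤ) : Fin d × Bool :=
  (exists_outwardStep z).choose

theorem le_latticeNorm_add_outwardStep [NeZero d] (z : Fin d → ℤ) (ℓ : ℕ) :
    latticeNorm z + ℓ / d ≤ latticeNorm (z + ℓ • unitStep (outwardStep z)) := by
  have hd : (1 : ℝ) ≤ d := by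
    have : 1 ≤ d := NeZero.one_le
    exact_mod_cast this
  have h := (exists_outwardStep z).choose_spec
  change latticeNorm z ≤ d * (stepCoord (outwardStep z) z : ℝ) at h
  refine (sq_le_sq₀ (add_nonneg (latticeNorm_nonneg _) (by positivity)) (latticeNorm_nonneg _)).1 ?_
  rw [latticeNorm_add_smul_sq]
  set c : ℝ := ((stepCoord (outwardStep z) z : ℤ) : ℝ)
  have h1 : latticeNorm z / d ≤ c := by
    rw [div_le_iff₀ (by linarith)]
    linarith
  have h2 : (ℓ : ℝ) / d ≤ ℓ := div_le_self (Nat.cast_nonneg ℓ) hd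
  have h3 : ((ℓ : ℝ) / d) ^ 2 ≤ (ℓ : ℝ) ^ 2 := pow_le_pow_left₀ (by positivity) h2 2
  have h4 : 2 * ℓ * (latticeNorm z / d) ≤ 2 * ℓ * c := mul_le_mul_of_nonneg_left h1 (by positivity)
  have h5 : latticeNorm z * (ℓ / d) = ℓ * (latticeNorm z / d) := by ring
  nlinarith

/-- The sites `z` with `a ≤ ‖z‖ < b`. -/
noncomputable def annulus (d : ℕ) (a b : ℝ) : Finset (Fin d → ℤ) :=
  (latticeBall_finite d b).toFinset.filter fun z => a ≤ latticeNorm z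

theorem mem_annulus {a b : ℝ} {z : Fin d → ℤ} :
    z ∈ annulus d a b ↔ a ≤ latticeNorm z ∧ latticeNorm z < b := by
  simp [annulus, latticeBall, and_comm]

theorem ballVolume_add_card_annulus {n k : ℕ} (h : n ≤ k) :
    ballVolume d n + (annulus d n k).card = ballVolume d k := by
  have hn : (n : ℝ) ≤ k := by exact_mod_cast h
  rw [ballVolume, ballVolume, Set.ncard_eq_toFinset_card _ (latticeBall_finite d n),
    Set.ncard_eq_toFinset_card _ (latticeBall_finite d k), ← Finset.card_union_of_disjoint]
  · congr 1
    ext z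
    simp only [Finset.mem_union, Set.Finite.mem_toFinset, mem_annulus, latticeBall,
      Set.mem_ofPred_eq]
    constructor
    · rintro (h | h)
      · exact h.trans_le hn
      · exact h.2
    · intro h
      exact (lt_or_ge _ _).imp_right fun h' => ⟨h', h⟩
  · refine Finset.disjoint_left.2 fun z hz hz' => ?_
    exact absurd ((latticeBall_finite d n).mem_toFinset.1 hz) (not_lt.2 (mem_annulus.1 hz').1)

theorem add_unitStep_mem_annulus {m : ℕ} {x : Fin d → ℤ} (hx : x ∈ latticeBall d m)
    (p : Fin d × Bool) (h : x + unitStep p ∉ latticeBall d m) :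
    x + unitStep p ∈ annulus d m (m + 1) := by
  refine mem_annulus.2 ⟨not_lt.1 h, ?_⟩
  have h1 := latticeNorm_add_le x (unitStep p)
  rw [latticeNorm_unitStep] at h1
  have h2 : latticeNorm x < m := hx
  linarith

/-- Pushing a thin shell outwards shows that it is not much larger than a thicker shell of larger
radius. -/
theorem card_annulus_le [NeZero d] {m g : ℕ} :
    (annulus d m (m + 1)).card ≤
      2 * d * (annulus d (m + g : ℕ) (m + g + (d * g + 1) : ℕ)).card := by
  classical
  have hd : (1 : ℝ) ≤ d := by
    have : 1 ≤ d := NeZero.one_le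
    exact_mod_cast this
  refine Finset.card_le_mul_card_image_of_maps_to
    -- A push by `d * g` outward steps raises the norm by at least `g` and at most `d * g`. A point
    -- has at most `2 * d` preimages, one for each direction.
    (f := fun z => z + (d * g) • unitStep (outwardStep z)) (fun z hz => ?_) _ fun y _ => ?_
  · rw [mem_annulus] at hz ⊢
    have h1 := le_latticeNorm_add_outwardStep z (d * g)
    have h2 := latticeNorm_add_smul_le z (d * g) (outwardStep z)
    push_cast at h1 h2 ⊢
    rw [mul_div_cancel_left₀ _ (by linarith)] at h1
    constructor
    · linarith
    · have : (0 : ℝ) ≤ g := Nat.cast_nonneg g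
      linarith
  · have hsub : (annulus d m (m + 1)).filter
        (fun z => z + (d * g) • unitStep (outwardStep z) = y) ⊆
        Finset.univ.image fun p : Fin d × Bool => y - (d * g) • unitStep p := fun z hz => by
      rw [Finset.mem_filter] at hz
      exact Finset.mem_image.2 ⟨outwardStep z, Finset.mem_univ _, by rw [← hz.2]; abel⟩
    refine (Finset.card_le_card hsub).trans (Finset.card_image_le.trans ?_)
    simp [mul_comm]

/-- In a coordinate plane, for each ordinate `y < n` take the least abscissa `x` for which `(x, y)`
is outside the open ball of radius `n`. The norm is then less than `n + 1`. This guarantees at least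
`n` new explorers. -/
theorem le_card_annulus (hd : 2 ≤ d) {n k : ℕ} (h : n < k) : n ≤ (annulus d n k).card := by
  classical
  have hex : ∀ y : ℕ, ∃ x : ℕ, n ^ 2 ≤ x ^ 2 + y ^ 2 := fun y => ⟨n, by lia⟩
  let i : Fin d := ⟨0, by lia⟩
  let j : Fin d := ⟨1, by lia⟩
  have hij : i ≠ j := by simp [i, j]
  let f : ℕ → Fin d → ℤ := fun y => Pi.single i (Nat.find (hex y) : ℤ) + Pi.single j (y : ℤ)
  have hfi : ∀ y, f y i = (Nat.find (hex y) : ℤ) := fun y => by simp [f, hij]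
  have hfj : ∀ y, f y j = y := fun y => by simp [f, hij.symm]
  have hnorm : ∀ y, latticeNorm (f y) ^ 2 = (Nat.find (hex y) : ℝ) ^ 2 + (y : ℝ) ^ 2 := fun y => by
    rw [latticeNorm_sq, ← Finset.add_sum_erase _ _ (Finset.mem_univ i), hfi,
      ← Finset.add_sum_erase _ _ (Finset.mem_erase.2 ⟨hij.symm, Finset.mem_univ j⟩), hfj,
      Finset.sum_eq_zero fun l hl => ?_]
    · simp
    · have h1 : l ≠ j := (Finset.mem_erase.1 hl).1
      have h2 : l ≠ i := (Finset.mem_erase.1 (Finset.mem_erase.1 hl).2).1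
      simp [f, h1, h2]
  have hcard := Finset.card_le_card_of_injOn (s := Finset.range n) (t := annulus d n k) f
    (fun y hy => ?_) (fun y _ y' _ hyy' => ?_)
  · simpa using hcard
  · have hy : y < n := by simpa using hy
    refine mem_annulus.2 ⟨?_, ?_⟩
    · refine (sq_le_sq₀ (Nat.cast_nonneg n) (latticeNorm_nonneg _)).1 ?_
      rw [hnorm]
      exact_mod_cast Nat.find_spec (hex y)
    · refine (sq_lt_sq₀ (latticeNorm_nonneg _) (Nat.cast_nonneg k)).1 ?_
      rw [hnorm]
      have hle : Nat.find (hex y) ≤ n := Nat.find_min' (hex y) (by lia)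
      obtain ⟨x, hx⟩ : ∃ x, Nat.find (hex y) = x + 1 := by
        refine Nat.exists_eq_succ_of_ne_zero fun h0 => ?_
        have := Nat.find_spec (hex y)
        rw [h0] at this
        nlinarith
      have hmin := Nat.find_min (hex y) (m := x) (by lia)
      rw [hx] at hle ⊢
      have : (x + 1) ^ 2 + y ^ 2 < k ^ 2 := by nlinarith
      exact_mod_cast this
  · have := congrFun hyy' j
    simpa [hfj] using this

/-- Filling a ball in this order, each site can be reached from the origin through sites already
filled. -/
theorem exists_enumeration_by_norm (F : Finset (Fin d → ℤ)) :
    ∃ t : ℕ → Fin d → ℤ, (∀ z ∈ F, ∃ i < F.card, t i = z) ∧ (∀ i < F.card, t i ∈ F) ∧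
      ∀ i < F.card, ∀ x ∈ F, latticeNorm x < latticeNorm (t i) → ∃ j < i, t j = x := by
  let e : Fin F.card → Fin d → ℤ := fun i => F.equivFin.symm i
  let σ := Tuple.sort (latticeNorm ∘ e)
  have hmono : Monotone ((latticeNorm ∘ e) ∘ σ) := Tuple.monotone_sort _
  have hsurj : ∀ z ∈ F, ∃ i, e (σ i) = z := fun z hz =>
    ⟨σ.symm (F.equivFin ⟨z, hz⟩), by simp [e]⟩
  refine ⟨fun i => if h : i < F.card then e (σ ⟨i, h⟩) else 0, fun z hz => ?_,
    fun i hi => ?_, fun i hi x hx hlt => ?_⟩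
  · obtain ⟨i, rfl⟩ := hsurj z hz
    exact ⟨i, i.2, by simp⟩
  · simp [hi, e]
  · obtain ⟨j, rfl⟩ := hsurj x hx
    refine ⟨j, ?_, by simp⟩
    by_contra hcon
    have := hmono (show (⟨i, hi⟩ : Fin F.card) ≤ j from not_lt.1 hcon)
    simp only [hi, dite_true] at hlt
    exact absurd this (not_le.2 hlt)

end InternalDLA

/-! ### Probability that some tentacle is filled. -/

namespace InternalDLA

theorem one_sub_exp_le_one_sub_pow {x y : ℝ} (hx : x ≤ 1) {K : ℕ} (hy : y ≤ K * x) :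
    1 - Real.exp (-y) ≤ 1 - (1 - x) ^ K := by
  have h1 : (1 - x) ^ K ≤ Real.exp (-x) ^ K :=
    pow_le_pow_left₀ (by linarith) (Real.one_sub_le_exp_neg x) K
  rw [← Real.exp_nat_mul] at h1
  have h2 : Real.exp (K * -x) ≤ Real.exp (-y) := Real.exp_le_exp.2 (by linarith)
  linarith

theorem half_le_one_sub_pow {x y : ℝ} (hx : x ≤ 1) {K : ℕ} (hy0 : 0 ≤ y) (hy1 : y ≤ 1)
    (hy : y ≤ K * x) : y / 2 ≤ 1 - (1 - x) ^ K := by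
  refine le_trans ?_ (one_sub_exp_le_one_sub_pow hx hy)
  have h1 := Real.add_one_le_exp y
  have h2 : Real.exp (-y) ≤ (1 + y)⁻¹ := by
    rw [Real.exp_neg]
    exact inv_anti₀ (by linarith) (by linarith)
  have h3 : (1 + y)⁻¹ ≤ 1 - y / 2 := by
    rw [inv_eq_one_div, div_le_iff₀ (by linarith)]
    nlinarith
  linarith

/-- Either some site succeeds with high probability, or the expected number of successful sites is
large. -/
theorem large_or_many_successes {ι : Type*} {Z : Finset ι} {p : ι → ℝ} {a : ι → ℕ → ℝ}
    {q : ℕ → ℝ} {d n N J : ℕ} {s : ℝ} (hd : 1 ≤ d) (hJ : 1 ≤ J) (hs : 1 ≤ s) (hsn : s ^ 4 = n)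
    (hN : n ≤ N) (hZ : Z.card ≤ 2 * d * N) (hp0 : ∀ z ∈ Z, 0 ≤ p z) (hp : 1 ≤ ∑ z ∈ Z, p z)
    (hq0 : ∀ j < J, 0 < q j) (hq1 : ∀ j < J, q j ≤ 1)
    (ha : ∀ z ∈ Z, ∀ j < J, p z * q j ≤ a z j) (ha1 : ∀ z j, a z j ≤ 1)
    (hc : s⁻¹ ≤ ∏ j : Fin J, q j / (16 * d * J)) :
    (∃ z ∈ Z, 1 - 2 / s ≤ ∏ j : Fin J, (1 - (1 - a z j) ^ (N / J))) ∨
      s / 2 ≤ ∑ z ∈ Z, ∏ j : Fin J, (1 - (1 - a z j) ^ (N / J)) := by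
  classical
  have hs0 : 0 < s := by linarith
  have hd' : (1 : ℝ) ≤ d := by exact_mod_cast hd
  have hJ' : (1 : ℝ) ≤ J := by exact_mod_cast hJ
  have hdJ : (1 : ℝ) ≤ d * J := one_le_mul_of_one_le_of_one_le hd' hJ'
  have hfac0 : ∀ j : Fin J, 0 < q j / (16 * d * J) := fun j => div_pos (hq0 j j.2) (by nlinarith)
  have hfac1 : ∀ j : Fin J, q j / (16 * d * J) ≤ 1 := fun j => by
    rw [div_le_one (by nlinarith)]
    nlinarith [hq1 j j.2]
  have hfac : ∀ j : Fin J, s⁻¹ ≤ q j / (16 * d * J) := fun j => by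
    refine hc.trans ?_
    rw [← Finset.mul_prod_erase _ _ (Finset.mem_univ j)]
    refine mul_le_of_le_one_right (hfac0 j).le (Finset.prod_le_one ?_ ?_)
    · exact fun i _ => (hfac0 i).le
    · exact fun i _ => hfac1 i
  have hJs : (J : ℝ) ≤ s := by
    have h1 := hfac ⟨0, hJ⟩
    rw [inv_le_iff_one_le_mul₀ hs0, div_mul_eq_mul_div, le_div_iff₀ (by nlinarith)] at h1
    have h2 := hq1 0 hJ
    simp only at h1
    nlinarith
  have hNr : (n : ℝ) ≤ N := by exact_mod_cast hN
  have hs4 : s ≤ s ^ 4 := le_self_pow₀ hs (by norm_num)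
  have hJN : J ≤ N := by
    have : (J : ℝ) ≤ N := by linarith
    exact_mod_cast this
  have hN0 : (0 : ℝ) < N := by linarith
  set K := N / J with hK
  -- Rounding down in `N / J` loses at most a factor two because `J ≤ N`.
  have hKN : (N : ℝ) / (2 * J) ≤ K := by
    have h1 : 1 ≤ K := (Nat.one_le_div_iff (by lia)).2 hJN
    have h2 : N < J * (K + 1) := by
      rw [hK]
      exact Nat.lt_mul_div_succ N (by lia)
    have h3 : N ≤ K * (2 * J) := by nlinarith
    rw [div_le_iff₀ (by linarith)]
    exact_mod_cast h3
  -- At a heavy site the expected number of useful explorers in a block is at least `s⁴/(2J) * s⁻² *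
  -- q j ≥ 8 d s`, so all `J ≤ s` blocks succeed up to an error `s * exp (-s) ≤ 2/s`.
  by_cases hheavy : ∃ z ∈ Z, (s ^ 2)⁻¹ ≤ p z
  · obtain ⟨z, hz, hpz⟩ := hheavy
    refine .inl ⟨z, hz, ?_⟩
    have h1 : ∀ j : Fin J, 1 - Real.exp (-s) ≤ 1 - (1 - a z j) ^ K := fun j => by
      refine one_sub_exp_le_one_sub_pow (ha1 _ _) ?_
      have e1 : (s ^ 2)⁻¹ * q j ≤ a z j :=
        (mul_le_mul_of_nonneg_right hpz (hq0 j j.2).le).trans (ha z hz j j.2)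
      have e2 : s ^ 4 / (2 * J) * ((s ^ 2)⁻¹ * q j) ≤ K * a z j := by
        refine mul_le_mul (le_trans ?_ hKN) e1 ?_ (Nat.cast_nonneg _)
        · exact div_le_div_of_nonneg_right (by linarith) (by linarith)
        · exact mul_nonneg (by positivity) (hq0 j j.2).le
      refine le_trans ?_ e2
      have e3 := hfac j
      have e4 : s ^ 4 / (2 * J) * ((s ^ 2)⁻¹ * q j) = 8 * d * s ^ 2 * (q j / (16 * d * J)) := by
        field_simp
        ring
      rw [e4]
      have e5 : 8 * d * s ^ 2 * s⁻¹ ≤ 8 * d * s ^ 2 * (q j / (16 * d * J)) :=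
        mul_le_mul_of_nonneg_left e3 (by positivity)
      have e6 : 8 * d * s ^ 2 * s⁻¹ = 8 * d * s := by field_simp
      nlinarith
    have h2 : 0 ≤ 1 - Real.exp (-s) := by
      have := Real.exp_le_one_iff.2 (show -s ≤ 0 by linarith)
      linarith
    have h3 : (1 - Real.exp (-s)) ^ J ≤ ∏ j : Fin J, (1 - (1 - a z j) ^ K) := by
      have := Finset.prod_le_prod (s := Finset.univ) (fun (j : Fin J) _ => h2) fun j _ => h1 j
      simpa using this
    have h4 : 1 + (J : ℝ) * (-Real.exp (-s)) ≤ (1 + -Real.exp (-s)) ^ J :=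
      one_add_mul_le_pow (by linarith) J
    have h5 : Real.exp (-s) * s ≤ 2 / s := by
      rw [Real.exp_neg, inv_mul_eq_div, div_le_div_iff₀ (Real.exp_pos s) hs0]
      nlinarith [Real.quadratic_le_exp_of_nonneg hs0.le]
    have h6 : (J : ℝ) * Real.exp (-s) ≤ s * Real.exp (-s) :=
      mul_le_mul_of_nonneg_right hJs (Real.exp_pos _).le
    rw [← sub_eq_add_neg] at h4
    linarith
  · push Not at hheavy
    refine .inr ?_
    -- As `Z` has at most `2 d N` sites, those below this threshold carry mass at most `1/2`. The
    -- others carry at least `1/2`, each less than `s⁻²`, so there are at least `s²/2` of them.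
    set G := Z.filter fun z => (4 * d * N : ℝ)⁻¹ ≤ p z with hG
    have hbad : ∑ z ∈ Z.filter (fun z => ¬ (4 * d * N : ℝ)⁻¹ ≤ p z), p z ≤ 1 / 2 := by
      refine (Finset.sum_le_card_nsmul _ _ (4 * d * N : ℝ)⁻¹ fun z hz => ?_).trans ?_
      · exact (not_le.1 (Finset.mem_filter.1 hz).2).le
      · rw [nsmul_eq_mul]
        have : ((Z.filter fun z => ¬ (4 * d * N : ℝ)⁻¹ ≤ p z).card : ℝ) ≤ 2 * d * N := by
          exact_mod_cast (Finset.card_filter_le _ _).trans hZ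
        rw [mul_inv_le_iff₀ (by positivity)]
        linarith
    have hgood : 1 / 2 ≤ ∑ z ∈ G, p z := by
      have := Finset.sum_filter_add_sum_filter_not Z (fun z => (4 * d * N : ℝ)⁻¹ ≤ p z) p
      linarith
    have hcard : s ^ 2 / 2 ≤ G.card := by
      have := hgood.trans (Finset.sum_le_card_nsmul G p (s ^ 2)⁻¹ fun z hz =>
        (hheavy z (Finset.mem_filter.1 hz).1).le)
      rw [nsmul_eq_mul, ← div_eq_mul_inv, le_div_iff₀ (by positivity)] at this
      linarith
    have hnn : ∀ z ∈ Z, ∀ j : Fin J, 0 ≤ 1 - (1 - a z j) ^ K := fun z hz j => by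
      have h0 : 0 ≤ a z j := (mul_nonneg (hp0 z hz) (hq0 j j.2).le).trans (ha z hz j j.2)
      have := pow_le_one₀ (n := K) (show 0 ≤ 1 - a z j by linarith [ha1 z j]) (by linarith)
      linarith
    have hP : ∀ z ∈ G, s⁻¹ ≤ ∏ j : Fin J, (1 - (1 - a z j) ^ K) := fun z hz => by
      obtain ⟨hzZ, hpz⟩ := Finset.mem_filter.1 hz
      refine hc.trans (Finset.prod_le_prod (fun j _ => (hfac0 j).le) fun j _ => ?_)
      -- `q j / (8 d J)` is the lower bound `N/(2J) * q j/(4dN)` for the mean number of useful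
      -- explorers; the last `/ 2` comes from `1 - exp (-y) ≥ y / 2` on `[0, 1]`.
      have e0 : q j / (16 * d * J) = q j / (8 * d * J) / 2 := by
        field_simp
        ring
      rw [e0]
      refine half_le_one_sub_pow (ha1 _ _) (div_nonneg (hq0 j j.2).le (by positivity)) ?_ ?_
      · rw [div_le_one (by nlinarith)]
        nlinarith [hq1 j j.2]
      · have e1 : (4 * d * N : ℝ)⁻¹ * q j ≤ a z j :=
          (mul_le_mul_of_nonneg_right hpz (hq0 j j.2).le).trans (ha z hzZ j j.2)
        have e2 : (N : ℝ) / (2 * J) * ((4 * d * N : ℝ)⁻¹ * q j) ≤ K * a z j :=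
          mul_le_mul hKN e1 (mul_nonneg (by positivity) (hq0 j j.2).le) (Nat.cast_nonneg _)
        refine le_trans (le_of_eq ?_) e2
        field_simp
        ring
    have h1 := Finset.card_nsmul_le_sum G _ _ hP
    rw [nsmul_eq_mul] at h1
    have h2 : ∑ z ∈ G, ∏ j : Fin J, (1 - (1 - a z j) ^ K) ≤
        ∑ z ∈ Z, ∏ j : Fin J, (1 - (1 - a z j) ^ K) :=
      Finset.sum_le_sum_of_subset_of_nonneg (Finset.filter_subset _ _)
        fun z hz _ => Finset.prod_nonneg fun j _ => hnn z hz j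
    have h3 : s / 2 ≤ G.card * s⁻¹ := by
      rw [← div_eq_mul_inv, le_div_iff₀ hs0]
      linarith
    linarith

/-- The step sequences for which the walk from the origin leaves `D` at `z` and then visits the
`j`-th site of the sequence `t`, remaining before that time in the preceding sites. -/
def tentacleEvent {d : ℕ} (D : Set (Fin d → ℤ)) (t : (Fin d → ℤ) → ℕ → Fin d → ℤ)
    (z : Fin d → ℤ) (j : ℕ) : Set (ℕ → Fin d → ℤ) :=
  {ξ | HitsThen D z {ξ | HitsThen (t z '' {i | i < j}) (t z j) Set.univ z ξ} 0 ξ}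

theorem measurableSet_tentacleEvent {d : ℕ} (D : Set (Fin d → ℤ))
    (t : (Fin d → ℤ) → ℕ → Fin d → ℤ) (z : Fin d → ℤ) (j : ℕ) :
    MeasurableSet (tentacleEvent D t z j) :=
  measurableSet_hitsThen _ _ (measurableSet_hitsThen _ _ .univ _) _

namespace AreIndepSimpleRandomWalks

variable {Ω : Type*} [MeasurableSpace Ω] {μ : Measure Ω} {d : ℕ} {S : ℕ → ℕ → Ω → (Fin d → ℤ)}

/-- The conditioning event is measurable with respect to the first `b(n)` walks, hence independent
of all later blocks. -/
theorem exists_preimage_innerError (hS : AreIndepSimpleRandomWalks μ S) (n : ℕ) (c : ℝ) :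
    ∃ Γ : Set (Finset.range (ballVolume d n) → ℕ → Fin d → ℤ), MeasurableSet Γ ∧
      {ω | innerError (fun i t => S i t ω) n < c} =
        (fun ω (i : Finset.range (ballVolume d n)) => increments S i ω) ⁻¹' Γ := by
  let path : (Finset.range (ballVolume d n) → ℕ → Fin d → ℤ) → ℕ → ℕ → Fin d → ℤ :=
    fun η i t => if h : i ∈ Finset.range (ballVolume d n) then walkPath 0 (η ⟨i, h⟩) t else 0
  have hpath : Measurable path := by
    refine measurable_pi_iff.2 fun i => measurable_pi_iff.2 fun t => ?_
    by_cases h : i ∈ Finset.range (ballVolume d n)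
    · simp only [path, h, dite_true]
      exact (measurable_walkPath 0 t).comp (measurable_pi_apply _)
    · simp only [path, h, dite_false]
      exact measurable_const
  refine ⟨path ⁻¹' {w | innerError w n < c}, hpath (measurableSet_innerError_lt n c), ?_⟩
  ext ω
  have : cluster (fun i t => S i t ω) (ballVolume d n) =
      cluster (path fun i => increments S i ω) (ballVolume d n) := by
    refine cluster_congr fun i hi => ?_
    funext t
    simp only [path, Finset.mem_range.2 hi, dite_true]
    exact hS.eq_walkPath i t ω
  simp only [Set.mem_preimage, Set.mem_ofPred_eq, innerError, this]

variable [IsProbabilityMeasure μ] [NeZero d]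

theorem measureReal_inter_tentacleFailure_le (hS : AreIndepSimpleRandomWalks μ S) (hd : 2 ≤ d)
    {m g J : ℕ} {s : ℝ} {t : (Fin d → ℤ) → ℕ → Fin d → ℤ} {q : ℕ → ℝ} (hm : 0 < m) (hJ : 1 ≤ J)
    (hs : 1 ≤ s) (hsn : s ^ 4 = (m + g : ℕ)) (hq0 : ∀ j < J, 0 < q j)
    (hq : ∀ z, ∀ j < J, q j ≤ hitProb (t z '' {i | i < j}) (t z j) z)
    (hc : s⁻¹ ≤ ∏ j : Fin J, q j / (16 * d * J))
    {Γ : Set (Finset.range (ballVolume d (m + g)) → ℕ → Fin d → ℤ)} (hΓ : MeasurableSet Γ) :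
    μ.real ((fun ω (i : Finset.range (ballVolume d (m + g))) => increments S i ω) ⁻¹' Γ ∩
      ⋂ z ∈ annulus d m (m + 1), (blockSuccess (increments S) (ballVolume d (m + g)) J
        ((annulus d (m + g : ℕ) (m + g + (d * g + 1) : ℕ)).card / J)
        (tentacleEvent (latticeBall d m) t) z)ᶜ) ≤
    μ.real ((fun ω (i : Finset.range (ballVolume d (m + g))) => increments S i ω) ⁻¹' Γ) *
      (2 / s) := by
  have hA := measurableSet_tentacleEvent (latticeBall d m) t
  rw [measureReal_inter_blockFailure hS.measurable_increments hS.iIndepFun_increments _ _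
    (fun z _ j => hA z j) hΓ]
  refine mul_le_mul_of_nonneg_left ?_ measureReal_nonneg
  set N := (annulus d (m + g : ℕ) (m + g + (d * g + 1) : ℕ)).card with hN
  set Z := annulus d m (m + 1) with hZ
  have hmem0 : (0 : Fin d → ℤ) ∈ latticeBall d m := by
    change latticeNorm _ < _
    rw [latticeNorm_zero]
    exact_mod_cast hm
  have hsucc := fun z => measureReal_blockSuccess (J := J) (K := N / J)
    hS.measurable_increments hS.iIndepFun_increments hS.map_increments (ballVolume d (m + g))
    (A := tentacleEvent (latticeBall d m) t) (hA z)
  have hFm := fun z => measurableSet_blockSuccess (J := J) (K := N / J)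
    hS.measurable_increments (ballVolume d (m + g)) (hA z)
  have key := large_or_many_successes (Z := Z) (p := fun z => hitProb (latticeBall d m) z 0)
    (a := fun z j => (stepsLaw d).real (tentacleEvent (latticeBall d m) t z j)) (q := q) (N := N)
    (by lia : 1 ≤ d) hJ hs hsn (le_card_annulus hd (by lia)) card_annulus_le
    (fun z _ => hitProb_nonneg _ _ _)
    (one_le_sum_hitProb (latticeBall_finite d m) Z
      (fun x hx p hp => add_unitStep_mem_annulus hx p hp) hmem0)
    hq0 (fun j hj => (hq 0 j hj).trans (hitProb_le_one _ _ _))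
    (fun z _ j hj => (mul_le_mul_of_nonneg_left (hq z j hj) (hitProb_nonneg _ _ _)).trans
      (hitProb_mul_le_hitsThen (latticeBall_finite d m) z (measurableSet_hitsThen _ _ .univ _) 0))
    (fun _ _ => measureReal_le_one) hc
  -- With a heavy site, its own failure probability suffices. Otherwise the second moment bound
  -- applies, the tentacle events at distinct `z` being disjoint by uniqueness of the exit site.
  rcases key with ⟨z, hz, h⟩ | h
  · refine (measureReal_mono (Set.biInter_subset_of_mem hz)).trans ?_
    rw [probReal_compl_eq_one_sub (hFm z), hsucc]
    linarith
  · have hpos : 0 < ∑ z ∈ Z, μ.real (blockSuccess (increments S) (ballVolume d (m + g)) J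
        (N / J) (tentacleEvent (latticeBall d m) t) z) := by
      simp only [hsucc]
      linarith
    refine (measureReal_iInter_compl_le Z (fun z _ => hFm z) (fun z hz z' hz' hne => ?_) hpos).trans ?_
    · refine measureReal_blockSuccess_inter_le hS.measurable_increments hS.iIndepFun_increments
        hS.map_increments _ (hA z) (hA z') fun j => ?_
      refine Set.disjoint_left.2 fun ξ h1 h2 => hne (hitsThen_unique ?_ ?_ h1 h2)
      · exact not_lt.2 (mem_annulus.1 hz).1
      · exact not_lt.2 (mem_annulus.1 hz').1
    · simp only [hsucc]
      rw [← inv_div]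
      exact inv_anti₀ (by linarith) h

/-- If the cluster of `b(n)` explorers contains a ball of radius close to `n`, then with high
probability a tentacle grows before the radius increases much. -/
theorem measureReal_no_tentacle_le (hS : AreIndepSimpleRandomWalks μ S) (hd : 2 ≤ d)
    {m g J : ℕ} {s c c' : ℝ} {t : (Fin d → ℤ) → ℕ → Fin d → ℤ} {q : ℕ → ℝ} (hm : 0 < m)
    (hJ : 1 ≤ J) (hs : 1 ≤ s) (hsn : s ^ 4 = (m + g : ℕ)) (hq0 : ∀ j < J, 0 < q j)
    (hq : ∀ z, ∀ j < J, q j ≤ hitProb (t z '' {i | i < j}) (t z j) z)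
    (hc : s⁻¹ ≤ ∏ j : Fin J, q j / (16 * d * J)) (hg : c ≤ g)
    (htip : ∃ j < J, ∀ z, m ≤ latticeNorm z →
      (m + g + (d * g + 1) : ℕ) + c' ≤ latticeNorm (t z j)) :
    μ.real ({ω | innerError (fun i t => S i t ω) (m + g) < c} ∩
      {ω | c' ≤ outerError (fun i t => S i t ω) (m + g + (d * g + 1))}ᶜ) ≤
    μ.real {ω | innerError (fun i t => S i t ω) (m + g) < c} * (2 / s) := by
  obtain ⟨Γ, hΓ, hE⟩ := hS.exists_preimage_innerError (m + g) c
  have main := hS.measureReal_inter_tentacleFailure_le hd hm hJ hs hsn hq0 hq hc hΓ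
  rw [← hE] at main
  refine le_trans (measureReal_mono ?_) main
  rintro ω ⟨hω, hout⟩
  refine ⟨hω, ?_⟩
  simp only [Set.mem_iInter]
  intro z hz hsucc
  refine hout ?_
  obtain ⟨j, hj, hnorm⟩ := htip
  refine le_outerError ?_ (hnorm z (mem_annulus.1 hz).1)
  set N := (annulus d (m + g : ℕ) (m + g + (d * g + 1) : ℕ)).card with hN
  have hball : latticeBall d m ⊆ cluster (fun i t => S i t ω) (ballVolume d (m + g)) := by
    refine fun x hx => latticeBall_subset_of_innerError_lt hω ?_
    have hx : latticeNorm x < m := hx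
    change latticeNorm x < _
    push_cast
    linarith
  rw [← ballVolume_add_card_annulus (show m + g ≤ m + g + (d * g + 1) by lia)]
  -- The blocks use `J * (N / J) ≤ N` explorers; those left over do no harm.
  refine cluster_mono _ (Nat.add_le_add_left (Nat.mul_div_le N J) _)
    (mem_cluster_of_blocks hball (t z) (J := J) (K := N / J) (fun j hj => ?_) J le_rfl j hj)
  obtain ⟨k, hk⟩ := hsucc ⟨j, hj⟩
  obtain ⟨τ, h1, h2⟩ := exists_time_of_hitsThen hk
  refine ⟨k, k.2, τ, ?_, fun r hr => ?_⟩
  · rw [hS.eq_walkPath]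
    exact h1
  · rw [hS.eq_walkPath]
    exact h2 r hr

/-- With positive probability the explorers fill the ball of radius `n` exactly, in order of
increasing norm. Without this the conditional probability could be degenerate. -/
theorem measureReal_innerError_lt_pos (hS : AreIndepSimpleRandomWalks μ S) (n : ℕ) {c : ℝ}
    (hc : 0 < c) : 0 < μ.real {ω | innerError (fun i t => S i t ω) n < c} := by
  obtain ⟨t, ht1, ht2, ht3⟩ := exists_enumeration_by_norm (latticeBall_finite d n).toFinset
  have hcard : (latticeBall_finite d n).toFinset.card = ballVolume d n :=
    (Set.ncard_eq_toFinset_card _ _).symm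
  rw [hcard] at ht1 ht2 ht3
  set b := ballVolume d n
  let A : ℕ → Set (ℕ → Fin d → ℤ) := fun i => {ξ | HitsThen (t '' {j | j < i}) (t i) Set.univ 0 ξ}
  have hA : ∀ i, MeasurableSet (A i) := fun i => measurableSet_hitsThen _ _ .univ _
  have hpos : ∀ i < b, 0 < (stepsLaw d).real (A i) := fun i hi => by
    refine hitProb_zero_pos fun x hx => ?_
    have hti : latticeNorm (t i) < n := (latticeBall_finite d n).mem_toFinset.1 (ht2 i hi)
    exact ht3 i hi x ((latticeBall_finite d n).mem_toFinset.2 (hx.trans hti)) hx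
  have hprob : μ.real (⋂ i : Fin b, increments S i ⁻¹' A i) = ∏ i : Fin b, (stepsLaw d).real (A i) := by
    rw [Measure.real, (hS.iIndepFun_increments.precomp Fin.val_injective).meas_iInter
      fun i => ⟨A i, hA i, rfl⟩, ENNReal.toReal_prod]
    refine Finset.prod_congr rfl fun i _ => ?_
    rw [← hS.map_increments i, map_measureReal_apply (hS.measurable_increments i) (hA i)]
    rfl
  have hprob0 : 0 < μ.real (⋂ i : Fin b, increments S i ⁻¹' A i) := by
    rw [hprob]
    exact Finset.prod_pos fun i _ => hpos i i.2
  refine lt_of_lt_of_le hprob0 (measureReal_mono fun ω hω => ?_)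
  refine lt_of_le_of_lt (innerError_nonpos_of_subset fun x hx => ?_) hc
  obtain ⟨i, hi, rfl⟩ := ht1 x ((latticeBall_finite d n).mem_toFinset.2 hx)
  -- Blocks of a single explorer, starting from the empty cluster.
  have := mem_cluster_of_blocks (w := fun i t => S i t ω) (N := 0) (K := 1) (D := ∅)
    (Set.empty_subset _) t (J := b) (fun j hj => ?_) b le_rfl i hi
  · simpa using this
  · obtain ⟨τ, h1, h2, -⟩ := Set.mem_iInter.1 hω ⟨j, hj⟩
    refine ⟨0, one_pos, τ, ?_, fun r hr => .inr ?_⟩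
    · rw [hS.eq_walkPath]
      simpa using h1
    · rw [hS.eq_walkPath]
      simpa using h2 r hr

end AreIndepSimpleRandomWalks

end InternalDLA

/-! ### Straight tentacles, for dimension at least three. -/

namespace InternalDLA

theorem le_hitProb_of_path {d : ℕ} [NeZero d] {R : Set (Fin d → ℤ)} {l : ℕ}
    (u : ℕ → Fin d → ℤ) (h : ∀ i < l, u i ∈ R ∧ ∃ p, u (i + 1) = u i + unitStep p) :
    ((2 * d : ℝ)⁻¹) ^ l ≤ hitProb R (u l) (u 0) := by
  induction l generalizing u with
  | zero => simp [hitProb_self]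
  | succ l ih =>
    obtain ⟨h0, p, hp⟩ := h 0 (by lia)
    refine le_trans ?_ (hitProb_neighbor_le h0 p _)
    rw [← hp, pow_succ']
    exact mul_le_mul_of_nonneg_left (ih (fun i => u (i + 1)) fun i hi => h (i + 1) (by lia))
      (by positivity)

/-- Tentacles reaching at distance `(d + 4) * g` from the ball of radius `m`, which are sufficiently
easy to fill when the total number of candidate sites is of order `s ^ 4`. -/
structure HasTentacles (d : ℕ) [NeZero d] (g : ℕ) (s : ℝ) : Prop where
  exists_tentacle : ∃ (J : ℕ) (t : (Fin d → ℤ) → ℕ → Fin d → ℤ) (q : ℕ → ℝ), 1 ≤ J ∧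
    (∀ j < J, 0 < q j) ∧ (∀ z, ∀ j < J, q j ≤ hitProb (t z '' {i | i < j}) (t z j) z) ∧
    s⁻¹ ≤ ∏ j : Fin J, q j / (16 * d * J) ∧
    ∃ j < J, ∀ z, latticeNorm z + (d + 4) * g ≤ latticeNorm (t z j)

/-- The segment from `z` in its outward direction gains at least `1/d` per site, which explains `J`.
Forcing every step, its `j`-th site costs `(2d)^(-j)`, so the total exponent is of order `J²`. -/
theorem hasTentacles_of_line (d : ℕ) [NeZero d] {g J : ℕ} {s : ℝ} (hs : 0 < s)
    (hJ : J = d * (d + 4) * g + 1)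
    (hbound : 2 * d * (J : ℝ) ^ 2 + J * Real.log (16 * d * J) ≤ Real.log s) :
    HasTentacles d g s := by
  have hd : (1 : ℝ) ≤ d := by
    have : 1 ≤ d := NeZero.one_le
    exact_mod_cast this
  have hJ1 : (1 : ℝ) ≤ J := by
    have : 1 ≤ J := by lia
    exact_mod_cast this
  have hdJ : (0 : ℝ) < 16 * d * J := by positivity
  let t : (Fin d → ℤ) → ℕ → Fin d → ℤ := fun z j => z + j • unitStep (outwardStep z)
  refine ⟨J, t, fun j => ((2 * d : ℝ)⁻¹) ^ j, by lia, fun j _ => by positivity, fun z j _ => ?_, ?_,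
    J - 1, by lia, fun z => ?_⟩
  · have := le_hitProb_of_path (R := t z '' {i | i < j}) (l := j) (t z) fun i hi =>
      ⟨⟨i, hi, rfl⟩, outwardStep z, by simp only [t, succ_nsmul, add_assoc]⟩
    simpa [t] using this
  · have h1 : ∀ j : Fin J, Real.exp (-(2 * d * J + Real.log (16 * d * J))) ≤
        ((2 * d : ℝ)⁻¹) ^ (j : ℕ) / (16 * d * J) := fun j => by
      rw [neg_add, Real.exp_add, Real.exp_neg (Real.log _), Real.exp_log hdJ, div_eq_mul_inv]
      refine mul_le_mul_of_nonneg_right ?_ (by positivity)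
      have e1 : Real.exp (-(2 * d)) ≤ (2 * d : ℝ)⁻¹ := by
        rw [Real.exp_neg]
        exact inv_anti₀ (by positivity) (by linarith [Real.add_one_le_exp (2 * d : ℝ)])
      have e2 : Real.exp (-(2 * d * J)) = Real.exp (-(2 * d)) ^ J := by
        rw [← Real.exp_nat_mul]
        ring_nf
      rw [e2]
      refine (pow_le_pow_left₀ (Real.exp_pos _).le e1 J).trans ?_
      exact pow_le_pow_of_le_one (by positivity) (inv_le_one_of_one_le₀ (by linarith)) j.2.le
    have h2 := Finset.prod_le_prod (s := Finset.univ)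
      (fun (j : Fin J) _ => (Real.exp_pos (-(2 * d * J + Real.log (16 * d * J)))).le)
      fun j _ => h1 j
    refine le_trans ?_ h2
    rw [Finset.prod_const, Finset.card_univ, Fintype.card_fin, ← Real.exp_nat_mul,
      ← Real.exp_log hs, ← Real.exp_neg]
    refine Real.exp_le_exp.2 ?_
    nlinarith
  · refine le_trans (le_of_eq ?_) (le_latticeNorm_add_outwardStep z (J - 1))
    rw [hJ, Nat.add_sub_cancel]
    push_cast
    field_simp

theorem eventually_hasTentacles_of_three_le {d : ℕ} [NeZero d] (hd : 3 ≤ d) :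
    ∀ᶠ n : ℕ in atTop, ∀ g : ℕ, (g : ℝ) ≤ (8 * d ^ 2 * (d + 4) : ℝ)⁻¹ * errorScale d n + 1 →
      HasTentacles d g ((n : ℝ) ^ (1 / 4 : ℝ)) := by
  have hd' : (3 : ℝ) ≤ d := by exact_mod_cast hd
  set C : ℝ := d * (d + 4) + 1 with hC
  have hC0 : 1 ≤ C := by rw [hC]; nlinarith
  have hlog : Tendsto (fun n : ℕ => √(Real.log n)) atTop atTop :=
    Real.tendsto_sqrt_atTop.comp (Real.tendsto_log_atTop.comp tendsto_natCast_atTop_atTop)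
  have h1 : ∀ᶠ r : ℝ in atTop, Real.log (16 * d * r) ≤ (1 / 16) * r := by
    have h := (Real.isLittleO_log_id_atTop.comp_tendsto
      (tendsto_id.const_mul_atTop (show (0 : ℝ) < 16 * d by linarith))).bound
      (show (0 : ℝ) < 1 / (256 * d) by positivity)
    filter_upwards [h, eventually_ge_atTop 1] with r hr hr1
    simp only [Function.comp, id, Real.norm_eq_abs] at hr
    rw [abs_of_nonneg (by positivity : (0 : ℝ) ≤ 16 * d * r)] at hr
    refine (le_abs_self _).trans (hr.trans (le_of_eq ?_))
    field_simp
    ring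
  filter_upwards [hlog.eventually h1, hlog.eventually_ge_atTop (16 * d * C),
    eventually_ge_atTop 1] with n hn1 hn2 hn3 g hg
  have hn0 : (0 : ℝ) < n := by exact_mod_cast hn3
  have hL : 0 ≤ Real.log n := Real.log_natCast_nonneg n
  rw [errorScale, if_neg (by lia)] at hg
  set r := √(Real.log n) with hr
  have hrsq : r ^ 2 = Real.log n := Real.sq_sqrt hL
  have hr0 : 1 ≤ r := by nlinarith
  refine hasTentacles_of_line d (Real.rpow_pos_of_pos hn0 _) rfl ?_
  set J := d * (d + 4) * g + 1 with hJ
  rw [Real.log_rpow hn0, ← hrsq]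
  have hJr : (J : ℝ) ≤ (8 * d : ℝ)⁻¹ * r + C := by
    have e1 : (J : ℝ) = d * (d + 4) * g + 1 := by rw [hJ]; push_cast; ring
    have e2 : (d : ℝ) * (d + 4) * g ≤ d * (d + 4) * ((8 * d ^ 2 * (d + 4) : ℝ)⁻¹ * r + 1) :=
      mul_le_mul_of_nonneg_left hg (by positivity)
    have e3 : (d : ℝ) * (d + 4) * ((8 * d ^ 2 * (d + 4) : ℝ)⁻¹ * r + 1) =
        (8 * d : ℝ)⁻¹ * r + d * (d + 4) := by
      field_simp
    rw [e1, hC]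
    linarith
  have hCr : C ≤ (16 * d : ℝ)⁻¹ * r := by
    rw [inv_mul_eq_div, le_div_iff₀ (by positivity)]
    linarith
  -- With `r² = log n`, the two terms of the bound are then at most `9/128 r²` and `1/16 r²`, below
  -- `log s = r²/4`.
  have hJr' : (J : ℝ) ≤ 3 * ((16 * d : ℝ)⁻¹ * r) := by
    have : (8 * d : ℝ)⁻¹ * r = 2 * ((16 * d : ℝ)⁻¹ * r) := by field_simp; ring
    linarith
  have hJ1 : (1 : ℝ) ≤ J := by rw [hJ]; push_cast; nlinarith [Nat.cast_nonneg (α := ℝ) g]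
  have hJle : (J : ℝ) ≤ r := by
    refine hJr'.trans ?_
    have : (16 * d : ℝ)⁻¹ ≤ 1 / 48 := by
      rw [one_div]
      exact inv_anti₀ (by norm_num) (by linarith)
    nlinarith
  have hlogJ : Real.log (16 * d * J) ≤ (1 / 16) * r :=
    (Real.log_le_log (by positivity) (by gcongr)).trans hn1
  have e1 : 2 * d * (J : ℝ) ^ 2 ≤ 2 * d * (3 * ((16 * d : ℝ)⁻¹ * r)) ^ 2 := by gcongr
  have e2 : 2 * d * (3 * ((16 * d : ℝ)⁻¹ * r)) ^ 2 = (9 / 128) * (d : ℝ)⁻¹ * r ^ 2 := by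
    field_simp
    ring
  have e3 : (9 / 128) * (d : ℝ)⁻¹ * r ^ 2 ≤ (9 / 128) * r ^ 2 := by
    have : (d : ℝ)⁻¹ ≤ 1 := inv_le_one_of_one_le₀ (by linarith)
    nlinarith [sq_nonneg r]
  have e4 : (J : ℝ) * Real.log (16 * d * J) ≤ r * ((1 / 16) * r) := by
    refine mul_le_mul hJle hlogJ (Real.log_nonneg ?_) (by linarith)
    nlinarith
  nlinarith [sq_nonneg r]

end InternalDLA

/-! ### Plane coordinates and the crossing of a rectangle. -/

namespace InternalDLA

/-- Coordinates on `ℤ^2` centered at `z`, with ordinate axis in the direction `p`. -/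
def planeSite (p : Fin 2 × Bool) (z : Fin 2 → ℤ) (x y : ℤ) : Fin 2 → ℤ :=
  fun k => z k + if k = p.1 then (if p.2 then y else -y) else x

theorem planeSite_zero_natCast (p : Fin 2 × Bool) (z : Fin 2 → ℤ) (y : ℕ) :
    planeSite p z 0 y = z + y • unitStep p := by
  funext k
  rcases p with ⟨i, b⟩
  by_cases hk : k = i
  · subst hk
    cases b <;> simp [planeSite, unitStep]
  · simp [planeSite, unitStep, hk]

theorem planeSite_zero_zero (p : Fin 2 × Bool) (z : Fin 2 → ℤ) : planeSite p z 0 0 = z := by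
  funext k
  simp [planeSite]

/-- The abscissa in the coordinates `planeSite p z`. -/
def abscissa (p : Fin 2 × Bool) (z v : Fin 2 → ℤ) : ℤ := v (p.1 + 1) - z (p.1 + 1)

/-- The ordinate in the coordinates `planeSite p z`. -/
def ordinate (p : Fin 2 × Bool) (z v : Fin 2 → ℤ) : ℤ :=
  if p.2 then v p.1 - z p.1 else z p.1 - v p.1

theorem abscissa_planeSite (p : Fin 2 × Bool) (z : Fin 2 → ℤ) (x y : ℤ) :
    abscissa p z (planeSite p z x y) = x := by
  simp [abscissa, planeSite]

theorem ordinate_planeSite (p : Fin 2 × Bool) (z : Fin 2 → ℤ) (x y : ℤ) :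
    ordinate p z (planeSite p z x y) = y := by
  rcases p with ⟨i, b⟩
  cases b <;> simp [ordinate, planeSite]

theorem planeSite_add_unitStep (p p' : Fin 2 × Bool) (z : Fin 2 → ℤ) (x y : ℤ) :
    planeSite p z x y + unitStep p' =
      if p'.1 = p.1 then planeSite p z x (y + if p.2 = p'.2 then 1 else -1)
      else planeSite p z (x + if p'.2 then 1 else -1) y := by
  rcases p with ⟨i, b⟩
  rcases p' with ⟨i', b'⟩
  funext k
  by_cases hi : i' = i
  · subst hi
    by_cases hk : k = i'
    · subst hk
      cases b <;> cases b' <;> simp [planeSite, unitStep] <;> ring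
    · simp [planeSite, unitStep, hk]
  · have : k = i ↔ ¬ k = i' := by lia
    by_cases hk : k = i'
    · subst hk
      simp [planeSite, unitStep, hi, add_assoc]
    · have hk' := this.2 hk
      subst hk'
      simp [planeSite, unitStep, hi, hk]

theorem sum_planeSite_add_unitStep (p : Fin 2 × Bool) (z : Fin 2 → ℤ) (x y : ℤ)
    (F : (Fin 2 → ℤ) → ℝ) :
    ∑ p', F (planeSite p z x y + unitStep p') =
      F (planeSite p z (x + 1) y) + F (planeSite p z (x - 1) y) +
        F (planeSite p z x (y + 1)) + F (planeSite p z x (y - 1)) := by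
  rcases p with ⟨i, b⟩
  simp only [Fintype.sum_prod_type, Fintype.sum_bool, Fin.sum_univ_two, planeSite_add_unitStep,
    sub_eq_add_neg]
  fin_cases i <;> cases b <;> simp <;> ring

theorem planeSite_ordinate_succ (p : Fin 2 × Bool) (z : Fin 2 → ℤ) (x y : ℤ) :
    planeSite p z x (y + 1) = planeSite p z x y + unitStep p := by
  simp [planeSite_add_unitStep]

theorem planeSite_abscissa_add (p : Fin 2 × Bool) (z : Fin 2 → ℤ) (x y : ℤ) (b : Bool) :
    planeSite p z (x + if b then 1 else -1) y = planeSite p z x y + unitStep (p.1 + 1, b) := by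
  simp [planeSite_add_unitStep]

theorem one_add_sq_div_two_le_cosh (x : ℝ) : 1 + x ^ 2 / 2 ≤ Real.cosh x := by
  have h1 : Real.cosh x = 1 + 2 * Real.sinh (x / 2) ^ 2 := by
    rw [show x = 2 * (x / 2) by ring, Real.cosh_two_mul, Real.cosh_sq]
    ring_nf
  have h2 : (x / 2) ^ 2 ≤ Real.sinh (x / 2) ^ 2 := by
    rw [sq_le_sq]
    rcases le_total 0 (x / 2) with h | h
    · rw [abs_of_nonneg h, abs_of_nonneg (Real.sinh_nonneg_iff.2 h)]
      exact Real.self_le_sinh_iff.2 h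
    · rw [abs_of_nonpos h, abs_of_nonpos (Real.sinh_nonpos_iff.2 h)]
      exact neg_le_neg (Real.sinh_le_self_iff.2 h)
  rw [h1]
  linarith

/-- This makes `sinh (b y) * cos (b x)` discretely subharmonic wherever it is nonnegative. -/
theorem two_le_cosh_add_cos (x : ℝ) : 2 ≤ Real.cosh x + Real.cos x := by
  have := one_add_sq_div_two_le_cosh x
  have := Real.one_sub_sq_div_two_le_cos (x := x)
  linarith

theorem exp_neg_two_le : Real.exp (-2) ≤ (2 * (2 : ℕ) : ℝ)⁻¹ := by
  have h := Real.add_one_le_exp 1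
  have h2 : Real.exp 2 = Real.exp 1 * Real.exp 1 := by rw [← Real.exp_add]; norm_num
  rw [Real.exp_neg]
  refine inv_anti₀ (by norm_num) ?_
  push_cast
  nlinarith

theorem exp_neg_le_hitProb_row (p : Fin 2 × Bool) (z : Fin 2 → ℤ) {R : Set (Fin 2 → ℤ)}
    (x y : ℤ) (b : Bool) (l : ℕ)
    (hR : ∀ i < l, planeSite p z (x + i * if b then 1 else -1) y ∈ R) :
    Real.exp (-(2 * l)) ≤
      hitProb R (planeSite p z (x + l * if b then 1 else -1) y) (planeSite p z x y) := by
  have h := le_hitProb_of_path (R := R) (l := l)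
    (fun i => planeSite p z (x + i * if b then 1 else -1) y) fun i hi =>
      ⟨hR i hi, (p.1 + 1, b), by rw [← planeSite_abscissa_add]; push_cast; ring_nf⟩
  simp only [Nat.cast_zero, zero_mul, add_zero] at h
  refine le_trans ?_ h
  rw [show -(2 * (l : ℝ)) = l * (-2) by ring, Real.exp_nat_mul]
  exact pow_le_pow_left₀ (Real.exp_pos _).le exp_neg_two_le l

theorem exp_neg_le_hitProb_of_center (p : Fin 2 × Bool) (z : Fin 2 → ℤ) {R : Set (Fin 2 → ℤ)}
    {x y : ℤ} (hR : ∀ x' : ℤ, x'.natAbs < x.natAbs → planeSite p z x' y ∈ R) :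
    Real.exp (-(2 * x.natAbs)) ≤ hitProb R (planeSite p z x y) (planeSite p z 0 y) := by
  have h := exp_neg_le_hitProb_row p z (R := R) 0 y (decide (0 ≤ x)) x.natAbs fun i hi =>
    hR _ (by split_ifs <;> lia)
  convert h using 3
  by_cases hx : 0 ≤ x
  · simp only [hx, decide_true, if_true]
    lia
  · simp only [hx, decide_false, Bool.false_eq_true, if_false]
    lia

theorem exp_neg_le_hitProb_center (p : Fin 2 × Bool) (z : Fin 2 → ℤ) {R : Set (Fin 2 → ℤ)}
    {x y : ℤ} (hR : ∀ x' : ℤ, x'.natAbs ≤ x.natAbs → planeSite p z x' y ∈ R) :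
    Real.exp (-(2 * x.natAbs)) ≤ hitProb R (planeSite p z 0 y) (planeSite p z x y) := by
  have h := exp_neg_le_hitProb_row p z (R := R) x y (decide (x < 0)) x.natAbs fun i hi =>
    hR _ (by by_cases hx : x < 0 <;> simp [hx] <;> lia)
  convert h using 3
  by_cases hx : x < 0
  · simp only [hx, decide_true, if_true]
    lia
  · simp only [hx, decide_false, Bool.false_eq_true, if_false]
    lia

/-- Simple random walk crosses a rectangle of half-width `w` and height `H` with a probability at
least of order `exp (-2 * H / w)`. -/
theorem exp_neg_le_hitProb_crossing (p : Fin 2 × Bool) (z : Fin 2 → ℤ) {R : Set (Fin 2 → ℤ)}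
    {y₁ y₂ : ℤ} (hy : y₁ ≤ y₂) {w : ℕ}
    (hR : ∀ x y : ℤ, x.natAbs ≤ w → y₁ ≤ y → y ≤ y₂ → planeSite p z x y ∈ R) :
    Real.exp (-(3 * w + 2 * (y₂ - y₁ + 1) / (w + 1))) ≤
      hitProb R (planeSite p z 0 y₂) (planeSite p z 0 y₁) := by
  have hw : (0 : ℝ) < w + 1 := by positivity
  have hyr : (0 : ℝ) ≤ y₂ - y₁ := by
    have : (y₁ : ℝ) ≤ y₂ := by exact_mod_cast hy
    linarith
  rcases hy.eq_or_lt with rfl | hlt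
  · rw [hitProb_self]
    refine Real.exp_le_one_iff.2 ?_
    have : (0 : ℝ) ≤ 3 * w + 2 * (y₁ - y₁ + 1) / (w + 1) := by
      rw [sub_self]
      positivity
    linarith
  have hrow : ∀ x : ℤ, x.natAbs ≤ w →
      Real.exp (-(2 * w)) ≤ hitProb R (planeSite p z 0 y₂) (planeSite p z x y₂) := fun x hx => by
    refine le_trans (Real.exp_le_exp.2 ?_) (exp_neg_le_hitProb_center p z fun x' hx' =>
      hR x' y₂ (hx'.trans hx) hy le_rfl)
    have : (x.natAbs : ℝ) ≤ w := by exact_mod_cast hx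
    linarith
  -- The frequency for which `cos (b * x)` vanishes on the lateral sides `|x| = w + 1`.
  set b : ℝ := Real.pi / (2 * (w + 1)) with hb
  have hb0 : 0 < b := by positivity
  have hbw : b * (w + 1) = Real.pi / 2 := by rw [hb]; field_simp
  set H : ℝ := y₂ - y₁ + 1 with hH
  have hsinh : 0 < Real.sinh (b * H) := Real.sinh_pos_iff.2 (by positivity)
  set c : ℝ := Real.exp (-(2 * w)) / Real.sinh (b * H) with hc
  have hc0 : 0 < c := by positivity
  -- `f * c` is a subharmonic minorant of the hitting probability: it vanishes on the sides and just
  -- below the bottom row, and on the top row is at most `exp (-(2 * w))`, the cost of walking along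
  -- that row to its center.
  let f : ℤ → ℤ → ℝ := fun x y => Real.sinh (b * (y - y₁ + 1)) * Real.cos (b * x)
  have hcos : ∀ x : ℤ, x.natAbs ≤ w → 0 ≤ Real.cos (b * x) := fun x hx => by
    have h1 : |(x : ℝ)| ≤ w := by
      have : |x| ≤ (w : ℤ) := by rw [Int.abs_eq_natAbs]; lia
      exact_mod_cast this
    have h2 := abs_le.1 h1
    exact Real.cos_nonneg_of_neg_pi_div_two_le_of_le (by nlinarith) (by nlinarith)
  have hcos0 : ∀ x : ℤ, x.natAbs = w + 1 → Real.cos (b * x) = 0 := fun x hx => by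
    have h1 : |(x : ℝ)| = w + 1 := by
      have : |x| = (w : ℤ) + 1 := by rw [Int.abs_eq_natAbs]; lia
      exact_mod_cast this
    rw [← Real.cos_abs, abs_mul, abs_of_pos hb0, h1, hbw, Real.cos_pi_div_two]
  have havg : ∀ x y : ℤ, (f (x + 1) y + f (x - 1) y + f x (y + 1) + f x (y - 1)) / 4 =
      f x y * ((Real.cosh b + Real.cos b) / 2) := fun x y => by
    simp only [f]
    push_cast
    rw [show b * ((x : ℝ) + 1) = b * x + b by ring, show b * ((x : ℝ) - 1) = b * x - b by ring,
      show b * ((y : ℝ) + 1 - y₁ + 1) = b * (y - y₁ + 1) + b by ring,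
      show b * ((y : ℝ) - 1 - y₁ + 1) = b * (y - y₁ + 1) - b by ring, Real.cos_add, Real.cos_sub,
      Real.sinh_add, Real.sinh_sub]
    ring
  set V : Set (Fin 2 → ℤ) := (fun r : ℤ × ℤ => planeSite p z r.1 r.2) ''
    (Set.Icc (-(w : ℤ)) w ×ˢ Set.Ico y₁ y₂) with hV
  have hVfin : V.Finite := ((Set.finite_Icc _ _).prod (Set.finite_Ico _ _)).image _
  have hsub := subharmonic_nonpos hVfin
    (φ := fun v => f (abscissa p z v) (ordinate p z v) * c - hitProb R (planeSite p z 0 y₂) v) ?_ ?_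
  · have hmem : planeSite p z 0 y₁ ∈ V := ⟨(0, y₁), ⟨⟨by simp, by simp⟩, le_rfl, hlt⟩, rfl⟩
    have h1 := hsub _ hmem
    simp only [abscissa_planeSite, ordinate_planeSite, f, Int.cast_zero, mul_zero, Real.cos_zero,
      mul_one, sub_self, zero_add] at h1
    refine le_trans ?_ (by linarith : Real.sinh b * c ≤ _)
    -- At the start the minorant is `sinh b * c`. This bound adds `w` to the `2 * w` of the top row,
    -- and `π ≤ 4` gives `b * H ≤ 2 * H / (w + 1)`.
    have h2 : Real.exp (-w) ≤ Real.sinh b := by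
      refine le_trans ?_ (Real.self_le_sinh_iff.2 hb0.le)
      have h3 : Real.exp (-w) ≤ ((w : ℝ) + 1)⁻¹ := by
        rw [Real.exp_neg]
        exact inv_anti₀ hw (Real.add_one_le_exp _)
      refine h3.trans ?_
      rw [hb, inv_eq_one_div, div_le_div_iff₀ hw (by positivity)]
      nlinarith [Real.pi_gt_three]
    have h4 : Real.exp (-(2 * w)) * Real.exp (-(2 * H / (w + 1))) ≤ c := by
      rw [hc, div_eq_mul_inv]
      refine mul_le_mul_of_nonneg_left ?_ (Real.exp_pos _).le
      rw [Real.exp_neg]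
      refine inv_anti₀ hsinh ?_
      have h5 : Real.sinh (b * H) ≤ Real.exp (b * H) := by
        rw [Real.sinh_eq]
        linarith [Real.exp_pos (b * H), Real.exp_pos (-(b * H))]
      refine h5.trans (Real.exp_le_exp.2 ?_)
      rw [hb, div_mul_eq_mul_div]
      refine (div_le_div_iff₀ (by positivity) hw).2 ?_
      have : Real.pi * H ≤ 4 * H := mul_le_mul_of_nonneg_right Real.pi_le_four (by linarith)
      nlinarith
    have h6 : Real.exp (-(3 * w + 2 * H / (w + 1))) =
        Real.exp (-w) * (Real.exp (-(2 * w)) * Real.exp (-(2 * H / (w + 1)))) := by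
      rw [← Real.exp_add, ← Real.exp_add]
      ring_nf
    rw [h6]
    exact mul_le_mul h2 h4 (by positivity) (Real.sinh_nonneg_iff.2 hb0.le)
  · rintro _ ⟨⟨x, y⟩, ⟨⟨hx1, hx2⟩, hy1, hy2⟩, rfl⟩
    dsimp only at hx1 hx2 hy1 hy2 ⊢
    have h1 := neighborAverage_hitProb_le (planeSite p z 0 y₂)
      (hR x y (by lia) hy1 hy2.le)
    rw [neighborAverage_sub, neighborAverage_mul_const]
    have h2 : neighborAverage (fun v => f (abscissa p z v) (ordinate p z v)) (planeSite p z x y) =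
        f x y * ((Real.cosh b + Real.cos b) / 2) := by
      rw [← havg, neighborAverage, sum_planeSite_add_unitStep p z x y
        (fun v => f (abscissa p z v) (ordinate p z v))]
      simp only [abscissa_planeSite, ordinate_planeSite]
      push_cast
      ring
    rw [h2, abscissa_planeSite, ordinate_planeSite]
    have hf0 : 0 ≤ f x y := by
      refine mul_nonneg (Real.sinh_nonneg_iff.2 (mul_nonneg hb0.le ?_)) (hcos x (by lia))
      have : (y₁ : ℝ) ≤ y := by exact_mod_cast hy1
      linarith
    have h3 := two_le_cosh_add_cos b
    have h4 : f x y * c ≤ f x y * ((Real.cosh b + Real.cos b) / 2) * c := by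
      refine mul_le_mul_of_nonneg_right ?_ hc0.le
      nlinarith
    linarith
  · rintro _ ⟨⟨x, y⟩, ⟨⟨hx1, hx2⟩, hy1, hy2⟩, rfl⟩ p' hp'
    dsimp only at hx1 hx2 hy1 hy2 hp' ⊢
    obtain ⟨x', y', he, hxy⟩ : ∃ x' y', planeSite p z x y + unitStep p' = planeSite p z x' y' ∧
        (x' - x).natAbs + (y' - y).natAbs = 1 := by
      rw [planeSite_add_unitStep]
      by_cases h : p'.1 = p.1
      · refine ⟨x, _, if_pos h, ?_⟩
        split_ifs <;> lia
      · refine ⟨_, y, if_neg h, ?_⟩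
        split_ifs <;> lia
    rw [he] at hp' ⊢
    have hout : ¬ (-(w : ℤ) ≤ x' ∧ x' ≤ w ∧ y₁ ≤ y' ∧ y' < y₂) := fun h =>
      hp' ⟨(x', y'), ⟨⟨h.1, h.2.1⟩, h.2.2.1, h.2.2.2⟩, rfl⟩
    have h0 := hitProb_nonneg R (planeSite p z 0 y₂) (planeSite p z x' y')
    rw [abscissa_planeSite, ordinate_planeSite]
    have hcases : x'.natAbs = w + 1 ∨ y' = y₁ - 1 ∨ (y' = y₂ ∧ x'.natAbs ≤ w) := by lia
    rcases hcases with h | rfl | ⟨rfl, h⟩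
    · simp only [f, hcos0 x' h]
      linarith
    · simp only [f]
      push_cast
      rw [show (y₁ : ℝ) - 1 - y₁ + 1 = 0 by ring, mul_zero, Real.sinh_zero]
      linarith
    · have h1 := hrow x' h
      have h2 : f x' y' * c ≤ Real.exp (-(2 * w)) := by
        have h3 : f x' y' * c = Real.exp (-(2 * w)) * Real.cos (b * x') := by
          simp only [f, hc]
          rw [← hH]
          field_simp
        rw [h3]
        exact mul_le_of_le_one_right (Real.exp_pos _).le (Real.cos_le_one _)
      linarith

end InternalDLA

/-! ### Tapered tentacles in the plane. -/

namespace InternalDLA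

/-- The enumeration `0, -1, 1, -2, 2, …` of the integers. -/
def zigzag (k : ℕ) : ℤ := if k % 2 = 0 then (k / 2 : ℕ) else -((k + 1) / 2 : ℕ)

/-- The inverse of `zigzag`. -/
def zigzagIndex (x : ℤ) : ℕ := if 0 ≤ x then 2 * x.natAbs else 2 * x.natAbs - 1

theorem zigzagIndex_zigzag (k : ℕ) : zigzagIndex (zigzag k) = k := by
  unfold zigzagIndex zigzag
  split_ifs <;> lia

theorem zigzag_zigzagIndex (x : ℤ) : zigzag (zigzagIndex x) = x := by
  unfold zigzagIndex zigzag
  split_ifs <;> lia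

theorem zigzagIndex_le (x : ℤ) : zigzagIndex x ≤ 2 * x.natAbs := by
  unfold zigzagIndex
  split_ifs <;> lia

theorem zigzagIndex_lt {x x' : ℤ} (h : x'.natAbs < x.natAbs) : zigzagIndex x' < zigzagIndex x := by
  unfold zigzagIndex
  split_ifs <;> lia

/-- The half-width of the `y`-th row of a tapered tentacle: it is divided by two every `ℓ` rows. -/
def taperedWidth (M ℓ y : ℕ) : ℕ := 2 ^ (M - y / ℓ) - 1

theorem taperedWidth_add_one (M ℓ y : ℕ) : taperedWidth M ℓ y + 1 = 2 ^ (M - y / ℓ) :=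
  Nat.sub_add_cancel Nat.one_le_two_pow

theorem taperedWidth_lt (M ℓ y : ℕ) : taperedWidth M ℓ y < 2 ^ M := by
  have h1 := taperedWidth_add_one M ℓ y
  have h2 : 2 ^ (M - y / ℓ) ≤ 2 ^ M := Nat.pow_le_pow_right (by lia) (Nat.sub_le _ _)
  lia

/-- The sites of a tapered tentacle, row by row, each row being filled from its center; indices
which do not correspond to a site of the tentacle give the base site `z`. -/
noncomputable def taperedSite (M ℓ : ℕ) (z : Fin 2 → ℤ) (j : ℕ) : Fin 2 → ℤ :=
  if (zigzag (j % 2 ^ (M + 1))).natAbs ≤ taperedWidth M ℓ (j / 2 ^ (M + 1)) then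
    planeSite (outwardStep z) z (zigzag (j % 2 ^ (M + 1))) (j / 2 ^ (M + 1) : ℕ)
  else z

/-- Every row is padded to `2 ^ (M + 1)` indices, so quotient and remainder of the index give the
row and the position in it. -/
theorem planeSite_mem_image_taperedSite {M ℓ : ℕ} (z : Fin 2 → ℤ) {j y : ℕ} {x : ℤ}
    (hx : x.natAbs ≤ taperedWidth M ℓ y) (hj : y * 2 ^ (M + 1) + zigzagIndex x < j) :
    planeSite (outwardStep z) z x y ∈ taperedSite M ℓ z '' {i | i < j} := by
  refine ⟨_, hj, ?_⟩
  have hlt : zigzagIndex x < 2 ^ (M + 1) := by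
    have h1 := zigzagIndex_le x
    have h2 := taperedWidth_lt M ℓ y
    rw [pow_succ]
    lia
  have h1 : (y * 2 ^ (M + 1) + zigzagIndex x) / 2 ^ (M + 1) = y := by
    rw [mul_comm, Nat.mul_add_div (by positivity), Nat.div_eq_of_lt hlt, add_zero]
  have h2 : (y * 2 ^ (M + 1) + zigzagIndex x) % 2 ^ (M + 1) = zigzagIndex x := by
    rw [mul_comm, Nat.mul_add_mod, Nat.mod_eq_of_lt hlt]
  rw [taperedSite, h1, h2, zigzag_zigzagIndex, if_pos hx]

theorem natCast_taperedWidth (M ℓ y : ℕ) :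
    (taperedWidth M ℓ y : ℝ) = 2 ^ (M - y / ℓ) - 1 := by
  have := taperedWidth_add_one M ℓ y
  rw [eq_sub_iff_add_eq]
  exact_mod_cast this

theorem two_pow_sub_inv {M i : ℕ} (h : i ≤ M) : ((2 : ℝ) ^ (M - i))⁻¹ = 2 ^ i / 2 ^ M := by
  rw [pow_sub₀ _ two_ne_zero h, mul_inv, inv_inv]
  ring

/-- The stages of constant width are crossed one after the other. Stage `i` costs about `ℓ * 2 ^ i /
2 ^ M`, a geometric progression dominated by its last term. -/
theorem exp_neg_le_hitProb_axis {M ℓ : ℕ} (hℓ : 1 ≤ ℓ) (p : Fin 2 × Bool) (z : Fin 2 → ℤ)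
    {R : Set (Fin 2 → ℤ)} (hfin : R.Finite) {i y : ℕ} (hi : y / ℓ = i) (hiM : i ≤ M)
    (hR : ∀ (y' : ℕ) (x : ℤ), y' ≤ y → x.natAbs ≤ taperedWidth M ℓ y' → planeSite p z x y' ∈ R) :
    Real.exp (-(3 * (i + 1) * 2 ^ M + 4 * (ℓ + 1) * (2 ^ i / 2 ^ M))) ≤
      hitProb R (planeSite p z 0 y) z := by
  induction i generalizing y with
  | zero =>
    have hy : y < ℓ := (Nat.div_eq_zero_iff_lt (by lia)).1 hi
    have h := exp_neg_le_hitProb_crossing p z (R := R) (y₁ := 0) (y₂ := y) (by lia)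
      (w := taperedWidth M ℓ y) fun x y' hx h0 hy' => by
        obtain ⟨y', rfl⟩ := Int.eq_ofNat_of_zero_le h0
        refine hR y' x (by lia) (hx.trans (le_of_eq ?_))
        rw [taperedWidth, taperedWidth, hi, Nat.div_eq_of_lt (by lia)]
    rw [planeSite_zero_zero] at h
    refine le_trans (Real.exp_le_exp.2 (neg_le_neg ?_)) h
    have hw := natCast_taperedWidth M ℓ y
    rw [hi, Nat.sub_zero] at hw
    rw [hw, sub_add_cancel, div_eq_mul_inv _ ((2 : ℝ) ^ M)]
    have hP : (0 : ℝ) < ((2 : ℝ) ^ M)⁻¹ := by positivity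
    have hyr : (y : ℝ) ≤ ℓ := by exact_mod_cast hy.le
    have hy0 : (0 : ℝ) ≤ y := Nat.cast_nonneg y
    push_cast
    have : 2 * ((y : ℝ) - 0 + 1) * ((2 : ℝ) ^ M)⁻¹ ≤ 4 * (ℓ + 1) * ((2 : ℝ) ^ M)⁻¹ :=
      mul_le_mul_of_nonneg_right (by linarith) hP.le
    rw [pow_zero, one_div]
    linarith
  | succ i ih =>
    -- `y₀` is the last row of stage `i`. The next rectangle starts there with the narrower width of
    -- stage `i + 1`, so it fits in the tentacle.
    obtain ⟨y₀, hy₀⟩ : ∃ y₀, y₀ + 1 = (i + 1) * ℓ :=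
      ⟨(i + 1) * ℓ - 1, Nat.sub_add_cancel (Nat.mul_pos (by lia) hℓ)⟩
    have hmul : (i + 1) * ℓ = i * ℓ + ℓ := by ring
    have hy1 : (i + 1) * ℓ ≤ y := by
      rw [← hi]
      exact Nat.div_mul_le_self y ℓ
    have hy2 : y < (i + 1) * ℓ + ℓ := by
      have := Nat.lt_div_mul_add (a := y) (b := ℓ) (by lia)
      rwa [hi] at this
    have hdiv : y₀ / ℓ = i := by
      refine Nat.div_eq_of_lt_le (by lia) ?_
      lia
    have h1 := ih hdiv (by lia) fun y' x hy' hx => hR y' x (by lia) hx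
    have h2 := exp_neg_le_hitProb_crossing p z (R := R) (y₁ := y₀) (y₂ := y) (by lia)
      (w := taperedWidth M ℓ y) fun x y' hx h0 hy' => by
        obtain ⟨y', rfl⟩ := Int.eq_ofNat_of_zero_le (show 0 ≤ y' by lia)
        refine hR y' x (by lia) (hx.trans ?_)
        refine Nat.sub_le_sub_right (Nat.pow_le_pow_right (by lia) (Nat.sub_le_sub_left ?_ _)) 1
        exact Nat.div_le_div_right (by lia)
    refine le_trans ?_ (hitProb_mul_hitProb_le hfin subset_rfl z (planeSite p z 0 y₀)
      (planeSite p z 0 y))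
    refine le_trans ?_ (mul_le_mul h1 h2 (Real.exp_pos _).le (hitProb_nonneg _ _ _))
    rw [← Real.exp_add]
    refine Real.exp_le_exp.2 ?_
    have hw := natCast_taperedWidth M ℓ y
    rw [hi] at hw
    have hw2 : (taperedWidth M ℓ y : ℝ) ≤ 2 ^ M := by exact_mod_cast (taperedWidth_lt M ℓ y).le
    have h3 : 2 * (((y : ℤ) : ℝ) - ((y₀ : ℤ) : ℝ) + 1) / (taperedWidth M ℓ y + 1) ≤
        2 * (ℓ + 1) * (2 ^ (i + 1) / 2 ^ M) := by
      rw [hw, sub_add_cancel, div_eq_mul_inv, two_pow_sub_inv hiM]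
      refine mul_le_mul_of_nonneg_right ?_ (by positivity)
      have : (y : ℝ) ≤ y₀ + ℓ := by
        have : y ≤ y₀ + ℓ := by lia
        exact_mod_cast this
      push_cast
      linarith
    have h4 : (2 : ℝ) ^ (i + 1) / 2 ^ M = 2 * (2 ^ i / 2 ^ M) := by
      rw [pow_succ]
      ring
    rw [h4] at h3 ⊢
    push_cast at h3 ⊢
    linarith

/-- Climb the axis to the completed row below, step up, then walk along the current row, which is
filled from its center. The last two moves only contribute to the `2 ^ M` term. -/
theorem exp_neg_le_hitProb_taperedSite {M ℓ : ℕ} (hℓ : 1 ≤ ℓ) (z : Fin 2 → ℤ) {j : ℕ}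
    (hj : j / 2 ^ (M + 1) / ℓ ≤ M)
    (hx : (zigzag (j % 2 ^ (M + 1))).natAbs ≤ taperedWidth M ℓ (j / 2 ^ (M + 1))) :
    Real.exp (-(5 * (M + 1) * 2 ^ M + 4 * (ℓ + 1) * (2 ^ (j / 2 ^ (M + 1) / ℓ) / 2 ^ M))) ≤
      hitProb (taperedSite M ℓ z '' {i | i < j}) (taperedSite M ℓ z j) z := by
  rw [taperedSite, if_pos hx]
  set W := 2 ^ (M + 1) with hW
  set x := zigzag (j % W) with hxdef
  set R := taperedSite M ℓ z '' {i | i < j} with hRdef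
  have hjdec : j / W * W + j % W = j := Nat.div_add_mod' j W
  have hxk : zigzagIndex x = j % W := zigzagIndex_zigzag _
  have hfin : R.Finite := (Set.finite_lt_nat j).image _
  have hrow : ∀ x' : ℤ, x'.natAbs < x.natAbs →
      planeSite (outwardStep z) z x' (j / W : ℕ) ∈ R := fun x' hx' => by
    refine planeSite_mem_image_taperedSite z (hx'.le.trans hx) ?_
    have := zigzagIndex_lt hx'
    lia
  have hcenter := exp_neg_le_hitProb_of_center (outwardStep z) z (x := x) hrow
  have hxr : (x.natAbs : ℝ) + 1 ≤ 2 ^ M := by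
    have := hx.trans_lt (taperedWidth_lt M ℓ _)
    exact_mod_cast this
  have hP : (1 : ℝ) ≤ 2 ^ M := one_le_pow₀ (by norm_num)
  have hM0 : (0 : ℝ) ≤ M := Nat.cast_nonneg M
  have hE : (0 : ℝ) ≤ 4 * (ℓ + 1) * (2 ^ (j / W / ℓ) / 2 ^ M) := by positivity
  have hMP : (0 : ℝ) ≤ M * 2 ^ M := by positivity
  rcases Nat.eq_zero_or_pos (j / W) with h0 | hpos
  · rw [h0] at hcenter ⊢
    rw [Nat.cast_zero, planeSite_zero_zero] at hcenter
    refine le_trans (Real.exp_le_exp.2 (neg_le_neg ?_)) hcenter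
    rw [h0] at hE
    linarith
  · obtain ⟨y, hy⟩ := Nat.exists_eq_add_of_le' hpos
    have hrows : ∀ (y' : ℕ) (x' : ℤ), y' ≤ y → x'.natAbs ≤ taperedWidth M ℓ y' →
        planeSite (outwardStep z) z x' y' ∈ R := fun y' x' hy' hx' => by
      refine planeSite_mem_image_taperedSite z hx' ?_
      have h1 := zigzagIndex_le x'
      have h2 := taperedWidth_lt M ℓ y'
      have h3 : y' * W + W ≤ j / W * W := by
        rw [hy]
        calc y' * W + W = (y' + 1) * W := by ring
          _ ≤ (y + 1) * W := Nat.mul_le_mul_right W (by lia)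
      have h4 : W = 2 ^ M * 2 := pow_succ 2 M
      lia
    have hle : y / ℓ ≤ j / W / ℓ := Nat.div_le_div_right (by lia)
    have h1 := exp_neg_le_hitProb_axis hℓ (outwardStep z) z hfin (y := y) rfl (hle.trans hj) hrows
    have h2 := hitProb_neighbor_le (hrows y 0 le_rfl (Nat.zero_le _)) (outwardStep z)
      (planeSite (outwardStep z) z x (j / W : ℕ))
    rw [← planeSite_ordinate_succ] at h2
    rw [show ((y : ℤ) + 1) = ((j / W : ℕ) : ℤ) by rw [hy]; push_cast; rfl] at h2
    have h3 := (mul_le_mul exp_neg_two_le hcenter (Real.exp_pos _).le (by positivity)).trans h2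
    refine le_trans ?_ (hitProb_mul_hitProb_le hfin subset_rfl z
      (planeSite (outwardStep z) z 0 y) _)
    refine le_trans ?_ (mul_le_mul h1 h3 (by positivity) (hitProb_nonneg _ _ _))
    rw [← Real.exp_add, ← Real.exp_add]
    refine Real.exp_le_exp.2 ?_
    have h4 : 4 * ((ℓ : ℝ) + 1) * (2 ^ (y / ℓ) / 2 ^ M) ≤
        4 * (ℓ + 1) * (2 ^ (j / W / ℓ) / 2 ^ M) := by
      have : (2 : ℝ) ^ (y / ℓ) ≤ 2 ^ (j / W / ℓ) := pow_le_pow_right₀ (by norm_num) hle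
      gcongr
    have h5 : 3 * (((y / ℓ : ℕ) : ℝ) + 1) * 2 ^ M ≤ 3 * (M + 1) * 2 ^ M := by
      have : ((y / ℓ : ℕ) : ℝ) ≤ M := by exact_mod_cast hle.trans hj
      gcongr
    linarith

/-- The part of the cost of the `j`-th site of a tapered tentacle which is due to the length of
the tentacle. -/
noncomputable def taperedCost (M ℓ j : ℕ) : ℝ :=
  if (zigzag (j % 2 ^ (M + 1))).natAbs ≤ taperedWidth M ℓ (j / 2 ^ (M + 1)) then
    4 * (ℓ + 1) * (2 ^ (j / 2 ^ (M + 1) / ℓ) / 2 ^ M)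
  else 0

/-- Halving the width doubles the cost per site, so each row costs at most `8 * (ℓ + 1)` at every
stage. This balance is the reason for tapering. -/
theorem sum_taperedCost_le {M ℓ Y : ℕ} (hY : Y ≤ (M + 1) * ℓ) :
    ∑ j ∈ Finset.range (Y * 2 ^ (M + 1)), taperedCost M ℓ j ≤ Y * (8 * (ℓ + 1)) := by
  induction Y with
  | zero => simp
  | succ Y ih =>
    have hiM : Y / ℓ ≤ M := by
      have : Y / ℓ < M + 1 := Nat.div_lt_of_lt_mul (by lia)
      lia
    have hrow : ∑ k ∈ Finset.range (2 ^ (M + 1)), taperedCost M ℓ (Y * 2 ^ (M + 1) + k) ≤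
        8 * (ℓ + 1) := by
      have h1 : ∀ k ∈ Finset.range (2 ^ (M + 1)), taperedCost M ℓ (Y * 2 ^ (M + 1) + k) =
          if (zigzag k).natAbs ≤ taperedWidth M ℓ Y then
            4 * ((ℓ : ℝ) + 1) * (2 ^ (Y / ℓ) / 2 ^ M) else 0 := fun k hk => by
        have hk : k < 2 ^ (M + 1) := Finset.mem_range.1 hk
        have e1 : (Y * 2 ^ (M + 1) + k) / 2 ^ (M + 1) = Y := by
          rw [mul_comm, Nat.mul_add_div (by positivity), Nat.div_eq_of_lt hk, add_zero]
        have e2 : (Y * 2 ^ (M + 1) + k) % 2 ^ (M + 1) = k := by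
          rw [mul_comm, Nat.mul_add_mod, Nat.mod_eq_of_lt hk]
        rw [taperedCost, e1, e2]
      rw [Finset.sum_congr rfl h1, ← Finset.sum_filter, Finset.sum_const, nsmul_eq_mul]
      have hcard : ((Finset.range (2 ^ (M + 1))).filter
          fun k => (zigzag k).natAbs ≤ taperedWidth M ℓ Y).card ≤ 2 * 2 ^ (M - Y / ℓ) := by
        refine (Finset.card_le_card (t := Finset.range (2 * 2 ^ (M - Y / ℓ)))
          fun k hk => ?_).trans (by simp)
        have h2 := (Finset.mem_filter.1 hk).2
        have h3 := zigzagIndex_le (zigzag k)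
        rw [zigzagIndex_zigzag] at h3
        have h4 := taperedWidth_add_one M ℓ Y
        rw [Finset.mem_range]
        lia
      have hcard' : (((Finset.range (2 ^ (M + 1))).filter
          fun k => (zigzag k).natAbs ≤ taperedWidth M ℓ Y).card : ℝ) ≤ 2 * 2 ^ (M - Y / ℓ) := by
        exact_mod_cast hcard
      refine (mul_le_mul_of_nonneg_right hcard' (by positivity)).trans (le_of_eq ?_)
      rw [← two_pow_sub_inv hiM]
      field_simp
      ring
    rw [add_mul, one_mul, Finset.sum_range_add]
    have := ih (by lia)
    push_cast
    linarith

/-- The tip is the center of the last row; `12 = d * (d + 4)` for `d = 2`, since an outward step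
gains at least `1/2`. For height `H = (M + 1) * ℓ` the main cost `H * 8 * (ℓ + 1)` is of order `H² /
(M + 1)`. -/
theorem hasTentacles_of_tapered {M ℓ g J : ℕ} {s : ℝ} (hs : 0 < s) (hℓ : 1 ≤ ℓ)
    (hH : 12 * g + 1 ≤ (M + 1) * ℓ) (hJ : J = (M + 1) * ℓ * 2 ^ (M + 1))
    (hbound : J * (Real.log (32 * J) + 5 * (M + 1) * 2 ^ M) +
      (M + 1) * ℓ * (8 * (ℓ + 1)) ≤ Real.log s) : HasTentacles 2 g s := by
  have hW : 0 < 2 ^ (M + 1) := by positivity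
  have hJ1 : 1 ≤ J := by
    rw [hJ]
    exact Nat.mul_pos (by lia) hW
  have hJr : (0 : ℝ) < 32 * J := by
    have : (1 : ℝ) ≤ J := by exact_mod_cast hJ1
    linarith
  have hstage : ∀ j < J, j / 2 ^ (M + 1) / ℓ ≤ M := fun j hj => by
    rw [hJ] at hj
    have h1 : j / 2 ^ (M + 1) < ℓ * (M + 1) := Nat.div_lt_of_lt_mul (by lia)
    have h2 : j / 2 ^ (M + 1) / ℓ < M + 1 := Nat.div_lt_of_lt_mul h1
    lia
  refine ⟨J, taperedSite M ℓ, fun j => Real.exp (-(5 * (M + 1) * 2 ^ M + taperedCost M ℓ j)), hJ1,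
    fun j _ => Real.exp_pos _, fun z j hj => ?_, ?_, ((M + 1) * ℓ - 1) * 2 ^ (M + 1), ?_,
    fun z => ?_⟩
  · dsimp only
    by_cases h : (zigzag (j % 2 ^ (M + 1))).natAbs ≤ taperedWidth M ℓ (j / 2 ^ (M + 1))
    · rw [taperedCost, if_pos h]
      exact exp_neg_le_hitProb_taperedSite hℓ z (hstage j hj) h
    · rw [taperedCost, if_neg h]
      have : taperedSite M ℓ z j = z := if_neg h
      rw [this, hitProb_self]
      refine Real.exp_le_one_iff.2 ?_
      have : (0 : ℝ) ≤ 5 * (M + 1) * 2 ^ M := by positivity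
      linarith
  · have h1 : ∀ j : Fin J, Real.exp (-(5 * (M + 1) * 2 ^ M + taperedCost M ℓ j)) /
        (16 * (2 : ℕ) * J) = Real.exp (-(Real.log (32 * J) + 5 * (M + 1) * 2 ^ M) +
          -taperedCost M ℓ j) := fun j => by
      have h2 : (16 * ((2 : ℕ) : ℝ) * J) = Real.exp (Real.log (32 * J)) := by
        rw [Real.exp_log hJr]
        push_cast
        ring
      rw [h2, ← Real.exp_sub]
      ring_nf
    rw [Finset.prod_congr rfl fun j _ => h1 j, ← Real.exp_sum, ← Real.exp_log hs, ← Real.exp_neg]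
    refine Real.exp_le_exp.2 ?_
    simp only [Finset.sum_add_distrib, Finset.sum_neg_distrib]
    rw [Fin.sum_univ_eq_sum_range (fun j => taperedCost M ℓ j) J]
    have h3 := sum_taperedCost_le (M := M) (ℓ := ℓ) le_rfl
    rw [← hJ] at h3
    push_cast at h3
    simp only [Finset.sum_const, Finset.card_univ, Fintype.card_fin, nsmul_eq_mul]
    linarith
  · rw [hJ]
    exact Nat.mul_lt_mul_of_pos_right (by lia) hW
  · have h1 : ((M + 1) * ℓ - 1) * 2 ^ (M + 1) % 2 ^ (M + 1) = 0 := Nat.mul_mod_left _ _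
    have h2 : ((M + 1) * ℓ - 1) * 2 ^ (M + 1) / 2 ^ (M + 1) = (M + 1) * ℓ - 1 :=
      Nat.mul_div_cancel _ hW
    have h3 : zigzag 0 = 0 := rfl
    rw [taperedSite, h1, h2, h3, if_pos (by simp), planeSite_zero_natCast]
    refine le_trans ?_ (le_latticeNorm_add_outwardStep z _)
    have h4 : (12 * g : ℝ) ≤ ((M + 1) * ℓ - 1 : ℕ) := by
      have : 12 * g ≤ (M + 1) * ℓ - 1 := by lia
      exact_mod_cast this
    push_cast at h4 ⊢
    linarith

end InternalDLA

/-! ### Choice of the parameters and the main estimate. -/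

namespace InternalDLA

theorem hasTentacles_two_of_le {n g : ℕ} {u : ℝ} (hu : 16 ≤ u) (hun : u ^ 16 = Real.log n)
    (hn : 0 < n) (hlog : Real.log (832 * u ^ 10) ≤ u)
    (hg : (g : ℝ) ≤ 1 / 1000 * errorScale 2 n + 1) :
    HasTentacles 2 g ((n : ℝ) ^ (1 / 4 : ℝ)) := by
  have hn0 : (0 : ℝ) < n := by exact_mod_cast hn
  have hu0 : (0 : ℝ) < u := by linarith
  set v := Real.log u with hv
  have hvu : v ≤ u := (Real.log_le_sub_one_of_pos hu0).trans (by linarith)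
  have hv1 : 1 ≤ v := by
    rw [hv, Real.le_log_iff_exp_le hu0]
    linarith [Real.exp_one_lt_d9]
  have hE : errorScale 2 n ^ 2 = 16 * u ^ 16 * v := by
    have h1 : Real.log (u ^ 16) = 16 * v := by rw [Real.log_pow, hv]; norm_num
    rw [errorScale, if_pos rfl, ← hun, h1, Real.sq_sqrt (by positivity)]
    ring
  have hE0 : 0 ≤ errorScale 2 n := by
    rw [errorScale, if_pos rfl]
    exact Real.sqrt_nonneg _
  have hE9 : errorScale 2 n ≤ u ^ 9 := by
    refine (sq_le_sq₀ hE0 (by positivity)).1 ?_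
    rw [hE]
    have : 16 * v ≤ u ^ 2 := by nlinarith
    calc 16 * u ^ 16 * v = u ^ 16 * (16 * v) := by ring
      _ ≤ u ^ 16 * u ^ 2 := mul_le_mul_of_nonneg_left this (by positivity)
      _ = (u ^ 9) ^ 2 := by ring
  have hu9 : (16 : ℝ) ≤ u ^ 9 := hu.trans (le_self_pow₀ (by linarith) (by norm_num))
  have hg9 : (g : ℝ) ≤ u ^ 9 := by linarith
  have hg0 : (0 : ℝ) ≤ g := Nat.cast_nonneg g
  have hgsq : (g : ℝ) ^ 2 ≤ 32 / 1000000 * u ^ 16 * v + 2 := by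
    nlinarith [sq_nonneg (1 / 1000 * errorScale 2 n - 1)]
  -- `2 ^ M` is about `u = (log n)^(1/16)`: small enough for the terms in `2 ^ M` to be negligible,
  -- large enough that `M + 1 ≥ log u = log log n / 16`.
  set M := Nat.log 2 ⌊u⌋₊ with hM
  have hfl : ⌊u⌋₊ ≠ 0 := (Nat.floor_pos.2 (by linarith)).ne'
  have hMu : (2 : ℝ) ^ M ≤ u := by
    refine le_trans ?_ (Nat.floor_le hu0.le)
    exact_mod_cast Nat.pow_log_le_self 2 hfl
  have huM : u ≤ 2 ^ (M + 1) := by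
    refine (Nat.lt_floor_add_one u).le.trans ?_
    exact_mod_cast Nat.lt_pow_succ_log_self (by norm_num) ⌊u⌋₊
  have hvM : v ≤ M + 1 := by
    have h1 := Real.log_le_log hu0 huM
    rw [Real.log_pow] at h1
    have h2 : Real.log 2 ≤ 1 := by linarith [Real.log_two_lt_d9]
    push_cast at h1
    have h3 : ((M : ℝ) + 1) * Real.log 2 ≤ (M + 1) * 1 :=
      mul_le_mul_of_nonneg_left h2 (by positivity)
    linarith
  have hM1 : (M : ℝ) + 1 ≤ u := by
    refine le_trans ?_ hMu
    exact_mod_cast Nat.lt_two_pow_self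
  have hM0 : (0 : ℝ) < M + 1 := by positivity
  set ℓ := 12 * g / (M + 1) + 1 with hℓ
  set a : ℝ := 12 * g / (M + 1) with ha
  have ha0 : 0 ≤ a := by positivity
  have hℓa : (ℓ : ℝ) ≤ a + 1 := by
    rw [hℓ, ha]
    push_cast
    have := Nat.cast_div_le (α := ℝ) (m := 12 * g) (n := M + 1)
    push_cast at this
    linarith
  have haM : a * (M + 1) = 12 * g := by
    rw [ha]
    field_simp
  have hH : ((M : ℝ) + 1) * ℓ ≤ 13 * u ^ 9 := by
    have h1 : ((M : ℝ) + 1) * ℓ ≤ (M + 1) * (a + 1) := mul_le_mul_of_nonneg_left hℓa hM0.le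
    have h2 : u ≤ u ^ 9 := le_self_pow₀ (by linarith) (by norm_num)
    nlinarith
  -- The factor `log log n` in `h(n)²` cancels against `M + 1`. Multiplied by `8`, this leading cost
  -- stays well below `u ^ 16 / 4 = log s`; the rest is at most of order `u ^ 12`.
  have hag : a ^ 2 * (M + 1) ≤ 144 * (32 / 1000000 * u ^ 16 + 2) := by
    have h1 : a ^ 2 * (M + 1) * v ≤ 144 * (32 / 1000000 * u ^ 16 + 2) * v := by
      calc a ^ 2 * (M + 1) * v ≤ a ^ 2 * (M + 1) * (M + 1) :=
            mul_le_mul_of_nonneg_left hvM (by positivity)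
        _ = 144 * (g : ℝ) ^ 2 := by
            rw [show a ^ 2 * (M + 1) * ((M : ℝ) + 1) = (a * (M + 1)) ^ 2 by ring, haM]
            ring
        _ ≤ 144 * (32 / 1000000 * u ^ 16 * v + 2) := mul_le_mul_of_nonneg_left hgsq (by norm_num)
        _ ≤ 144 * (32 / 1000000 * u ^ 16 + 2) * v := by nlinarith
    exact le_of_mul_le_mul_right h1 (by linarith)
  refine hasTentacles_of_tapered (M := M) (ℓ := ℓ) (Real.rpow_pos_of_pos hn0 _) (by lia) ?_ rfl ?_
  · have := Nat.lt_mul_div_succ (12 * g) (Nat.succ_pos M)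
    rw [Nat.succ_eq_add_one] at this
    lia
  set J := (M + 1) * ℓ * 2 ^ (M + 1) with hJ
  have hJr : (J : ℝ) ≤ 26 * u ^ 10 := by
    rw [hJ, pow_succ]
    push_cast
    calc ((M : ℝ) + 1) * ℓ * (2 ^ M * 2) ≤ 13 * u ^ 9 * (u * 2) := by gcongr
      _ = 26 * u ^ 10 := by ring
  have hJ1 : (1 : ℝ) ≤ J := by
    have : 1 ≤ J := Nat.mul_pos (Nat.mul_pos (by lia) (by lia)) (by positivity)
    exact_mod_cast this
  have hlogJ : Real.log (32 * J) ≤ u :=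
    (Real.log_le_log (by linarith) (by linarith)).trans hlog
  rw [Real.log_rpow hn0, ← hun]
  have hlog0 : 0 ≤ Real.log (32 * J) := Real.log_nonneg (by linarith)
  have e1 : (J : ℝ) * (Real.log (32 * J) + 5 * (M + 1) * 2 ^ M) ≤
      26 * u ^ 10 * (u + 5 * u * u) := by gcongr
  have e2 : ((M : ℝ) + 1) * ℓ * (8 * (ℓ + 1)) ≤ (M + 1) * (a + 1) * (8 * ((a + 1) + 1)) := by
    gcongr
  have e3 : ((M : ℝ) + 1) * (a + 1) * (8 * ((a + 1) + 1)) =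
      8 * (a ^ 2 * (M + 1)) + 24 * (a * (M + 1)) + 16 * (M + 1) := by ring
  rw [e3, haM] at e2
  have p1 : u ^ 16 = u ^ 12 * u ^ 4 := by ring
  have p4 : (65536 : ℝ) ≤ u ^ 4 := by
    calc (65536 : ℝ) = 16 ^ 4 := by norm_num
      _ ≤ u ^ 4 := pow_le_pow_left₀ (by norm_num) hu 4
  have p12 : 65536 * u ^ 12 ≤ u ^ 16 := by
    rw [p1, mul_comm]
    exact mul_le_mul_of_nonneg_left p4 (by positivity)
  have hu1 : (1 : ℝ) ≤ u := by linarith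
  have p11 : u ^ 11 ≤ u ^ 12 := pow_le_pow_right₀ hu1 (by norm_num)
  have p9 : u ^ 9 ≤ u ^ 12 := pow_le_pow_right₀ hu1 (by norm_num)
  have pu : u ≤ u ^ 12 := le_self_pow₀ hu1 (by norm_num)
  have e4 : 26 * u ^ 10 * (u + 5 * u * u) = 26 * u ^ 11 + 130 * u ^ 12 := by ring
  rw [e4] at e1
  linarith

theorem eventually_hasTentacles_two :
    ∀ᶠ n : ℕ in atTop, ∀ g : ℕ, (g : ℝ) ≤ 1 / 1000 * errorScale 2 n + 1 →
      HasTentacles 2 g ((n : ℝ) ^ (1 / 4 : ℝ)) := by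
  have hu : Tendsto (fun n : ℕ => (Real.log n) ^ (1 / 16 : ℝ)) atTop atTop :=
    (tendsto_rpow_atTop (by norm_num)).comp
      (Real.tendsto_log_atTop.comp tendsto_natCast_atTop_atTop)
  have h1 : ∀ᶠ u : ℝ in atTop, Real.log (832 * u ^ 10) ≤ u := by
    have h := (Real.isLittleO_log_id_atTop).bound (show (0 : ℝ) < 1 / 20 by norm_num)
    filter_upwards [h, eventually_ge_atTop (2 * Real.log 832), eventually_ge_atTop 1]
      with u hu h2 h3
    have hu0 : 0 < u := by linarith
    rw [id, Real.norm_eq_abs, Real.norm_eq_abs, abs_of_pos hu0] at hu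
    rw [Real.log_mul (by norm_num) (by positivity), Real.log_pow]
    have := (le_abs_self _).trans hu
    push_cast
    linarith
  filter_upwards [hu.eventually h1, hu.eventually_ge_atTop 16, eventually_ge_atTop 1]
    with n hn1 hn2 hn3 g hg
  refine hasTentacles_two_of_le hn2 ?_ hn3 hn1 hg
  rw [← Real.rpow_natCast, ← Real.rpow_mul (Real.log_natCast_nonneg n)]
  norm_num

theorem exists_eventually_hasTentacles (d : ℕ) [NeZero d] (hd : 2 ≤ d) :
    ∃ α : ℝ, 0 < α ∧ α ≤ 1 ∧ ∀ᶠ n : ℕ in atTop, ∀ g : ℕ, (g : ℝ) ≤ α * errorScale d n + 1 →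
      HasTentacles d g ((n : ℝ) ^ (1 / 4 : ℝ)) := by
  rcases hd.eq_or_lt with rfl | hd
  · exact ⟨1 / 1000, by norm_num, by norm_num, eventually_hasTentacles_two⟩
  · have hd1 : (1 : ℝ) ≤ d := by
      have : 1 ≤ d := by lia
      exact_mod_cast this
    refine ⟨(8 * d ^ 2 * (d + 4) : ℝ)⁻¹, by positivity, inv_le_one_of_one_le₀ ?_,
      eventually_hasTentacles_of_three_le hd⟩
    nlinarith [sq_nonneg (d : ℝ)]

theorem tendsto_log_natCast : Tendsto (fun n : ℕ => Real.log n) atTop atTop :=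
  Real.tendsto_log_atTop.comp tendsto_natCast_atTop_atTop

theorem eventually_sqrt_log_le_errorScale (d : ℕ) :
    ∀ᶠ n : ℕ in atTop, √(Real.log n) ≤ errorScale d n := by
  filter_upwards [tendsto_log_natCast.eventually_ge_atTop (Real.exp 1)] with n hn
  rw [errorScale]
  split_ifs
  · have h0 : 0 < Real.log n := (Real.exp_pos 1).trans_le hn
    refine Real.sqrt_le_sqrt (le_mul_of_one_le_right h0.le ?_)
    rwa [Real.le_log_iff_exp_le h0]
  · exact le_rfl

theorem eventually_errorScale_le_log (d : ℕ) :
    ∀ᶠ n : ℕ in atTop, errorScale d n ≤ Real.log n := by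
  filter_upwards [tendsto_log_natCast.eventually_ge_atTop 1] with n hn
  rw [errorScale]
  split_ifs
  · rw [Real.sqrt_le_left (by linarith), sq]
    refine mul_le_mul_of_nonneg_left ?_ (by linarith)
    exact (Real.log_le_sub_one_of_pos (by linarith)).trans (by linarith)
  · rw [Real.sqrt_le_left (by linarith)]
    nlinarith

/-- The tentacle is observed at `k > n`, so its length, chosen from `h(n)`, must also dominate
`h(k)`. -/
theorem eventually_errorScale_le_two_mul (d : ℕ) :
    ∀ᶠ n : ℕ in atTop, ∀ k : ℕ, n ≤ k → k ≤ n ^ 2 → errorScale d k ≤ 2 * errorScale d n := by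
  filter_upwards [tendsto_log_natCast.eventually_ge_atTop 2, eventually_ge_atTop 1]
    with n hn hn1 k hnk hkn
  have hn0 : (0 : ℝ) < n := by exact_mod_cast hn1
  have hk0 : (0 : ℝ) < k := by exact_mod_cast hn1.trans hnk
  have h1 : Real.log n ≤ Real.log k := Real.log_le_log hn0 (by exact_mod_cast hnk)
  have h2 : Real.log k ≤ 2 * Real.log n := by
    have : Real.log k ≤ Real.log ((n : ℝ) ^ 2) := Real.log_le_log hk0 (by exact_mod_cast hkn)
    rwa [Real.log_pow, Nat.cast_ofNat] at this
  have hfour : ∀ x : ℝ, 2 * √x = √(4 * x) := fun x => by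
    rw [Real.sqrt_mul (by norm_num), show (4 : ℝ) = 2 ^ 2 by norm_num,
      Real.sqrt_sq (by norm_num)]
  rw [errorScale, errorScale]
  split_ifs
  · rw [hfour]
    refine Real.sqrt_le_sqrt ?_
    have h3 : Real.log (Real.log k) ≤ 2 * Real.log (Real.log n) := by
      have : Real.log (Real.log k) ≤ Real.log (Real.log n ^ 2) :=
        Real.log_le_log (by linarith) (h2.trans (by nlinarith))
      rwa [Real.log_pow, Nat.cast_ofNat] at this
    have h4 : 0 ≤ Real.log (Real.log k) := Real.log_nonneg (by linarith)
    have h5 := mul_le_mul h2 h3 h4 (by linarith)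
    linarith
  · rw [hfour]
    exact Real.sqrt_le_sqrt (by linarith)

/-- The event of the main estimate: a small inner error is followed by a large outer error. -/
theorem eventually_measureReal_no_large_outerError_le (d : ℕ) [NeZero d] (hd : 2 ≤ d) :
    ∃ α : ℝ, 0 < α ∧ ∀ᶠ n : ℕ in atTop,
      ∀ {Ω : Type*} [MeasurableSpace Ω] (μ : Measure Ω) [IsProbabilityMeasure μ]
        (S : ℕ → ℕ → Ω → (Fin d → ℤ)), AreIndepSimpleRandomWalks μ S →
        0 < μ.real {ω | innerError (fun i t => S i t ω) n < α * errorScale d n} ∧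
        μ.real ({ω | innerError (fun i t => S i t ω) n < α * errorScale d n} ∩
          {ω | ∃ k : ℕ, n < k ∧
            α * errorScale d k ≤ outerError (fun i t => S i t ω) k}ᶜ) ≤
          μ.real {ω | innerError (fun i t => S i t ω) n < α * errorScale d n} *
            (2 / (n : ℝ) ^ (1 / 4 : ℝ)) := by
  obtain ⟨α, hα, hα1, htent⟩ := exists_eventually_hasTentacles d hd
  refine ⟨α, hα, ?_⟩
  have hlogn : ∀ᶠ n : ℕ in atTop, Real.log n ≤ 1 / 4 * n := by
    have h := (Real.isLittleO_log_id_atTop.comp_tendsto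
      (tendsto_natCast_atTop_atTop (R := ℝ))).bound (show (0 : ℝ) < 1 / 4 by norm_num)
    filter_upwards [h] with n hn
    simp only [Function.comp, id, Real.norm_eq_abs, Nat.abs_cast] at hn
    exact (le_abs_self _).trans hn
  filter_upwards [htent, eventually_sqrt_log_le_errorScale d, eventually_errorScale_le_log d,
    eventually_errorScale_le_two_mul d, hlogn, eventually_ge_atTop (d + 8),
    tendsto_log_natCast.eventually_ge_atTop 1] with n hn1 hn2 hn3 hn4 hn5 hn6 hn7
  intro Ω _ μ _ S hS
  have hE : 1 ≤ errorScale d n := (Real.one_le_sqrt.2 hn7).trans hn2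
  set c := α * errorScale d n with hc
  have hc0 : 0 < c := mul_pos hα (by linarith)
  refine ⟨hS.measureReal_innerError_lt_pos n hc0, ?_⟩
  set g := ⌈c⌉₊ with hg
  have hgc : c ≤ g := Nat.le_ceil c
  have hgc1 : (g : ℝ) ≤ c + 1 := (Nat.ceil_lt_add_one hc0.le).le
  have hg1 : 1 ≤ g := Nat.ceil_pos.2 hc0
  have hnr : (8 : ℝ) ≤ n := by
    have : 8 ≤ n := by lia
    exact_mod_cast this
  have hcn : c ≤ errorScale d n := mul_le_of_le_one_left (by linarith) hα1
  have hgn : 2 * g ≤ n := by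
    have : (2 * g : ℝ) ≤ n := by linarith
    exact_mod_cast this
  clear_value g c
  obtain ⟨m, rfl⟩ := Nat.exists_eq_add_of_le' (show g ≤ n by lia)
  obtain ⟨J, t, q, hJ, hq0, hq, hprod, j, hj, htip⟩ := hn1 g hgc1
  have hkn : m + g + (d * g + 1) ≤ (m + g) ^ 2 := by nlinarith
  have hs0 : (0 : ℝ) ≤ (m + g : ℕ) := Nat.cast_nonneg _
  have main := hS.measureReal_no_tentacle_le hd (m := m) (g := g) (c := c)
    (c' := α * errorScale d (m + g + (d * g + 1))) (by lia) hJ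
    (Real.one_le_rpow (by linarith) (by norm_num))
    (by rw [← Real.rpow_natCast, ← Real.rpow_mul hs0]; norm_num) hq0 hq hprod hgc
    -- The tip has norm at least `m + (d + 4) g`. Exceeding `m + g + (d g + 1) + 2 c` needs `3 g ≥ 2
    -- c + 1`, which holds as `g ≥ c` and `g ≥ 1`.
    ⟨j, hj, fun z hz => by
      refine le_trans ?_ (htip z)
      have h1 := mul_le_mul_of_nonneg_left (hn4 _ (by lia) hkn) hα.le
      have h2 : (1 : ℝ) ≤ g := by exact_mod_cast hg1
      push_cast
      nlinarith⟩
  refine le_trans (measureReal_mono ?_) main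
  refine Set.inter_subset_inter_right _ (Set.compl_subset_compl.2 fun ω hω => ?_)
  exact ⟨_, by lia, hω⟩

end InternalDLA

/-! ### Conclusion: the conditional limit and the almost sure statement. -/

theorem proposition1p2 (d : ℕ) (hd : 2 ≤ d) :
    ∃ α : ℝ, 0 < α ∧
      ∀ {Ω : Type*} [MeasurableSpace Ω] (μ : Measure Ω) [IsProbabilityMeasure μ]
        (S : ℕ → ℕ → Ω → (Fin d → ℤ)),
        InternalDLA.AreIndepSimpleRandomWalks μ S →
        Tendsto
          (fun n : ℕ =>
            μ[{ω | ∃ k : ℕ, n < k ∧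
                α * InternalDLA.errorScale d k ≤
                  InternalDLA.outerError (fun i t => S i t ω) k} |
              {ω | InternalDLA.innerError (fun i t => S i t ω) n <
                  α * InternalDLA.errorScale d n}])
          atTop (𝓝 1) ∧
        ∀ᵐ ω ∂μ, ∃ᶠ n : ℕ in atTop,
          α * √(Real.log n) ≤ InternalDLA.innerError (fun i t => S i t ω) n ∨
          α * √(Real.log n) ≤ InternalDLA.outerError (fun i t => S i t ω) n := by
  have : NeZero d := ⟨by lia⟩
  obtain ⟨α, hα, hev⟩ := InternalDLA.eventually_measureReal_no_large_outerError_le d hd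
  refine ⟨α, hα, ?_⟩
  intro Ω _ μ _ S hS
  set E : ℕ → Set Ω := fun n => {ω | InternalDLA.innerError (fun i t => S i t ω) n <
    α * InternalDLA.errorScale d n}
  set B : ℕ → Set Ω := fun n => {ω | ∃ k : ℕ, n < k ∧ α * InternalDLA.errorScale d k ≤
    InternalDLA.outerError (fun i t => S i t ω) k}
  have hbound : ∀ᶠ n : ℕ in atTop, 0 < μ.real (E n) ∧
      μ.real (E n ∩ (B n)ᶜ) ≤ μ.real (E n) * (2 / (n : ℝ) ^ (1 / 4 : ℝ)) :=
    hev.mono fun n hn => hn μ S hS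
  have hlim : Tendsto (fun n : ℕ => 2 / (n : ℝ) ^ (1 / 4 : ℝ)) atTop (𝓝 0) :=
    ((tendsto_rpow_atTop (by norm_num)).comp tendsto_natCast_atTop_atTop).const_div_atTop 2
  have hEm : ∀ n, MeasurableSet (E n) := fun n => by
    obtain ⟨Γ, hΓ, h⟩ := hS.exists_preimage_innerError n (α * InternalDLA.errorScale d n)
    change MeasurableSet {ω | _}
    rw [h]
    exact (measurable_pi_iff.2 fun i : Finset.range _ => hS.measurable_increments i :
      Measurable fun ω (i : Finset.range (InternalDLA.ballVolume d n)) =>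
        InternalDLA.increments S i ω) hΓ
  refine ⟨?_, ?_⟩
  · have hlow : Tendsto (fun n : ℕ => 1 - ENNReal.ofReal (2 / (n : ℝ) ^ (1 / 4 : ℝ)))
        atTop (𝓝 1) := by
      have h1 := ENNReal.tendsto_ofReal hlim
      rw [ENNReal.ofReal_zero] at h1
      have h2 := ENNReal.Tendsto.sub (tendsto_const_nhds (x := (1 : ENNReal)) (f := atTop)) h1
        (Or.inl ENNReal.one_ne_top)
      rwa [tsub_zero] at h2
    refine tendsto_of_tendsto_of_tendsto_of_le_of_le' hlow tendsto_const_nhds ?_ ?_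
    · filter_upwards [hbound] with n hn
      have hne : μ (E n) ≠ 0 := fun h0 => by
        have := hn.1
        rw [Measure.real, h0] at this
        simp at this
      have := cond_isProbabilityMeasure (μ := μ) hne
      rw [tsub_le_iff_right]
      -- Subadditivity is enough, so the measurability of `B n` plays no role.
      have h1 : (1 : ENNReal) ≤ μ[|E n] (B n) + μ[|E n] (B n)ᶜ := by
        rw [← measure_univ (μ := μ[|E n]), ← Set.union_compl_self (B n)]
        exact measure_union_le _ _
      refine h1.trans (add_le_add le_rfl ?_)
      rw [cond_apply (hEm n)]
      have h2 : μ (E n ∩ (B n)ᶜ) ≤ μ (E n) * ENNReal.ofReal (2 / (n : ℝ) ^ (1 / 4 : ℝ)) := by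
        rw [← ofReal_measureReal (μ := μ) (s := E n ∩ (B n)ᶜ),
          ← ofReal_measureReal (μ := μ) (s := E n), ← ENNReal.ofReal_mul measureReal_nonneg]
        exact ENNReal.ofReal_le_ofReal hn.2
      calc (μ (E n))⁻¹ * μ (E n ∩ (B n)ᶜ)
          ≤ (μ (E n))⁻¹ * (μ (E n) * ENNReal.ofReal (2 / (n : ℝ) ^ (1 / 4 : ℝ))) :=
            mul_le_mul_right h2 _
        _ = ENNReal.ofReal (2 / (n : ℝ) ^ (1 / 4 : ℝ)) := by
            rw [← mul_assoc, ENNReal.inv_mul_cancel hne (measure_ne_top _ _), one_mul]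
    · filter_upwards [hbound] with n hn
      exact prob_le_one
  · obtain ⟨N, hN⟩ := eventually_atTop.1 (InternalDLA.eventually_sqrt_log_le_errorScale d)
    -- For every large `m ≥ n` this event lies in `E m ∩ (B m)ᶜ`, because `√(log k) ≤ h(k)`; its
    -- probability is thus at most `2 / m^(1/4)` for all such `m`.
    have hnull : ∀ n : ℕ, μ {ω | ∀ k ≥ n,
        ¬ (α * √(Real.log k) ≤ InternalDLA.innerError (fun i t => S i t ω) k ∨
          α * √(Real.log k) ≤ InternalDLA.outerError (fun i t => S i t ω) k)} = 0 := fun n => by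
      rw [← measureReal_eq_zero_iff]
      refine le_antisymm (ge_of_tendsto hlim ?_) measureReal_nonneg
      filter_upwards [hbound, eventually_ge_atTop n, eventually_ge_atTop N] with m hm hmn hmN
      have hsub : {ω | ∀ k ≥ n,
          ¬ (α * √(Real.log k) ≤ InternalDLA.innerError (fun i t => S i t ω) k ∨
            α * √(Real.log k) ≤ InternalDLA.outerError (fun i t => S i t ω) k)} ⊆
          E m ∩ (B m)ᶜ := fun ω hω => by
        have hscale : ∀ k ≥ m, α * √(Real.log k) ≤ α * InternalDLA.errorScale d k := fun k hk =>
          mul_le_mul_of_nonneg_left (hN k (hmN.trans hk)) hα.le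
        refine ⟨?_, ?_⟩
        · exact (not_le.1 (not_or.1 (hω m hmn)).1).trans_le (hscale m le_rfl)
        · rintro ⟨k, hk, hout⟩
          exact (not_or.1 (hω k (hmn.trans hk.le))).2 ((hscale k hk.le).trans hout)
      refine (measureReal_mono hsub).trans (hm.2.trans ?_)
      exact mul_le_of_le_one_left (by positivity) measureReal_le_one
    rw [ae_iff]
    refine measure_mono_null (fun ω hω => ?_) (measure_iUnion_null hnull)
    obtain ⟨n, hn⟩ := eventually_atTop.1 (not_frequently.1 hω)
    exact Set.mem_iUnion.2 ⟨n, hn⟩
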